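/- Let $(\Omega,\mathcal H,\hat{\mathbb E})$ be a sublinear expectation space: $\mathcal H$ is a linear space of real functions on $\Omega$ such that $\varphi(Z_1,\dots,Z_n)\in\mathcal H$ whenever $Z_1,\dots,Z_n\in\mathcal H$ and $\varphi\in C_{Lip}(\mathbb R^n)$ (the Lipschitz functions on $\mathbb R^n$), and $\hat{\mathbb E}:\mathcal H\to\mathbb R$ is monotone, constant preserving, sub-additive and positively homogeneous. Assume that $\hat{\mathbb E}$ is regular, i.e. $\hat{\mathbb E}[Z_i]\downarrow 0$ for every sequence $Z_i\in\mathcal H$ with $Z_i\downarrow 0$ pointwise. Let $\{X_i\}_{i\ge1}\subset\mathcal H$ be i.i.d.: for all $i$ and all bounded Lipschitz $\varphi$ on $\mathbb R$, $\hat{\mathbb E}[\varphi(X_i)]=\hat{\mathbb E}[\varphi(X_1)]$, and for all $n\ge1$ and all bounded Lipschitz $\varphi$ on $\mathbb R^{n+1}$, $$\hat{\mathbb E}[\varphi(X_1,\dots,X_{n+1})]=\hat{\mathbb E}\Big[\hat{\mathbb E}[\varphi(x_1,\dots,x_n,X_{n+1})]\big|_{(x_1,\dots,x_n)=(X_1,\dots,X_n)}\Big].$$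 Assume also that $\lim_{\lambda\to\infty}\hat{\mathbb E}[(|X_1|-\lambda)^+]=0$. Let $\mathcal P_*$ be the set of probability measures $P$ on $(\Omega,\sigma(\mathcal H))$ with $E_P[Z]\le\hat{\mathbb E}[Z]$ for all $Z\in\mathcal H$, and let $\mathcal P_*\circ\boldsymbol X^{-1}=\{P\circ(X_1,X_2,\dots)^{-1}:P\in\mathcal P_*\}$, a set of laws on $(\mathbb R^{\mathbb N},\mathcal B(\mathbb R^{\mathbb N}))$. Let $\mathcal P_1$ be the set of probability measures $\mu$ on $\mathbb R$ with $E_\mu[\varphi]\le\hat{\mathbb E}[\varphi(X_1)]$ for all $\varphi\in C_{Lip}(\mathbb R)$. Let $\mathcal P$ be the set of probability measures $P$ on $\mathbb R^{\mathbb N}$ for which there are $\mu_1\in\mathcal P_1$ and probability kernels $\kappa_i$, $i\ge2$, with $\kappa_i(x_1,\dots,x_{i-1},\cdot)\in\mathcal P_1$ for all $(x_1,\dots,x_{i-1})\in\mathbb R^{i-1}$, such that for all $n\ge1$ and $A\in\mathcal B(\mathbb R^n)$ $$P(A\times\mathbb R^{\mathbb N-n})=\int_{\mathbb R}\mu_1(dx_1)\int_{\mathbb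 R}\kappa_2(x_1,dx_2)\cdots\int_{\mathbb R} I_A(x_1,\dots,x_n)\,\kappa_n(x_1,\dots,x_{n-1},dx_n).$$ Let $\mathcal Q_{\max}$ be the set of probability measures $\mu$ on $\mathbb R^{\mathbb N}$ such that $E_\mu[\varphi(Y_1,\dots,Y_n)]\le\hat{\mathbb E}[\varphi(X_1,\dots,X_n)]$ for all $n\ge 1$ and $\varphi\in C_{Lip}(\mathbb R^n)$, where $Y_i$ are the coordinate maps. (All the inequalities between expectations include the integrability of the functions concerned.) Then $$\mathcal P_*\circ\boldsymbol X^{-1}=\mathcal P=\mathcal Q_{\max}.$$ Moreover $\mathcal P_*\ne\emptyset$ and $\hat{\mathbb E}[Z]=\sup_{P\in\mathcal P_*}E_P[Z]$ for all $Z\in\mathcal H$; and, when $\hat{\mathbb E}$ is extended by this formula to bounded $\sigma(\mathcal H)$-measurable $Z$, for every $n$ and every bounded Borel measurable $f:\mathbb R^n\to\mathbb R$, $$\hat{\mathbb E}[f(X_1,\dots,X_n)]=\sup_{P\in\mathcal P}E_P[f(Y_1,\dots,Y_n)].$$ -/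

import Mathlib

open MeasureTheory ProbabilityTheory Filter Topology
open scoped ENNReal

/-- `φ ∈ C_Lip(ℝⁿ)`: `φ` is Lipschitz (the choice of norm on `ℝⁿ` is immaterial). -/
def IsLip {n : ℕ} (φ : (Fin n → ℝ) → ℝ) : Prop :=
  ∃ K : NNReal, LipschitzWith K φ

/-- `φ ∈ C_{b.Lip}(ℝⁿ)`: `φ` is bounded and Lipschitz. -/
def IsBddLip {n : ℕ} (φ : (Fin n → ℝ) → ℝ) : Prop :=
  IsLip φ ∧ ∃ C : ℝ, ∀ x, |φ x| ≤ C

/-- A sublinear expectation space `(Ω, H, E)`: a linear space `H` of real functions on `Ω`, stable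
under composition with Lipschitz functions of finitely many variables, with a sublinear
expectation on `H`. The functional `E` is written as a total function, but only its values
on `H` carry meaning: all laws concern elements of `H`. -/
structure SublinearExpectationSpace (Ω : Type*) where
  H : Submodule ℝ (Ω → ℝ)
  comp_mem : ∀ (n : ℕ) (Z : Fin n → Ω → ℝ), (∀ i, Z i ∈ H) →
    ∀ φ : (Fin n → ℝ) → ℝ, IsLip φ → (fun ω => φ (fun i => Z i ω)) ∈ H
  E : (Ω → ℝ) → ℝ
  mono : ∀ Y ∈ H, ∀ Z ∈ H, (∀ ω, Y ω ≤ Z ω) → E Y ≤ E Z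
  const : ∀ c : ℝ, E (fun _ => c) = c
  subadd : ∀ Y ∈ H, ∀ Z ∈ H, E (fun ω => Y ω + Z ω) ≤ E Y + E Z
  pos_homog : ∀ c : ℝ, 0 ≤ c → ∀ Z ∈ H, E (fun ω => c * Z ω) = c * E Z

namespace SublinearExpectationSpace

variable {Ω : Type*} (S : SublinearExpectationSpace Ω)

/-- Regularity: `E[Z_i] ↓ 0` whenever `Z_i ∈ H` and `Z_i ↓ 0` pointwise. -/
def Regular : Prop :=
  ∀ Z : ℕ → Ω → ℝ, (∀ i, Z i ∈ S.H) → (∀ ω, Antitone (fun i => Z i ω)) →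
    (∀ ω, Tendsto (fun i => Z i ω) atTop (𝓝 0)) →
      Tendsto (fun i => S.E (Z i)) atTop (𝓝 0)

/-- `Y` and `Z` are identically distributed. -/
def IdentDistributed (Y Z : Ω → ℝ) : Prop :=
  ∀ φ : ℝ → ℝ, (∃ K : NNReal, LipschitzWith K φ) → (∃ C : ℝ, ∀ x, |φ x| ≤ C) →
    S.E (fun ω => φ (Y ω)) = S.E (fun ω => φ (Z ω))

/-- `X n` is independent of `(X 0, …, X (n - 1))`. -/
def IndepOfPast (X : ℕ → Ω → ℝ) (n : ℕ) : Prop :=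
  ∀ φ : (Fin (n + 1) → ℝ) → ℝ, IsBddLip φ →
    S.E (fun ω => φ (fun i => X i ω)) =
      S.E (fun ω => S.E (fun ω' =>
        φ (Fin.snoc (α := fun _ => ℝ) (fun i : Fin n => X i ω) (X n ω'))))

/-- The sequence `X 0, X 1, …` of elements of `H` is i.i.d. under `E`. -/
structure IsIID (X : ℕ → Ω → ℝ) : Prop where
  mem : ∀ i, X i ∈ S.H
  indep : ∀ n, 1 ≤ n → S.IndepOfPast X n
  ident : ∀ i, S.IdentDistributed (X i) (X 0)

/-- `σ(H)`, the smallest σ-algebra making every element of `H` Borel measurable. -/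
abbrev sigmaH : MeasurableSpace Ω :=
  ⨆ Z ∈ S.H, MeasurableSpace.comap Z (borel ℝ)

/-- The set `P_*` of probability measures on `(Ω, σ(H))` dominated by `E` on `H`. -/
def dominatedMeasures : Set (@Measure Ω S.sigmaH) :=
  {P | IsProbabilityMeasure P ∧ ∀ Z ∈ S.H, Integrable Z P ∧ ∫ ω, Z ω ∂P ≤ S.E Z}

/-- The set `P_* ∘ X⁻¹` of laws on `ℝ^ℕ` of the whole sequence. -/
def imageLaws (X : ℕ → Ω → ℝ) : Set (Measure (ℕ → ℝ)) :=
  {Q | ∃ P ∈ S.dominatedMeasures,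
    Q = @Measure.map Ω (ℕ → ℝ) S.sigmaH inferInstance (fun ω i => X i ω) P}

/-- The marginal set: probability measures on `ℝ` dominated by the distribution of `Z` under
`E` on Lipschitz functions. -/
def marginalLaws (Z : Ω → ℝ) : Set (Measure ℝ) :=
  {μ | IsProbabilityMeasure μ ∧ ∀ φ : ℝ → ℝ, (∃ K : NNReal, LipschitzWith K φ) →
    Integrable φ μ ∧ ∫ x, φ x ∂μ ≤ S.E (fun ω => φ (Z ω))}

/-- The set `Q_max`: probability measures on `ℝ^ℕ` dominated by `E` on all cylinder Lipschitz
functions. -/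
def maximalLaws (X : ℕ → Ω → ℝ) : Set (Measure (ℕ → ℝ)) :=
  {Q | IsProbabilityMeasure Q ∧ ∀ (n : ℕ) (φ : (Fin n → ℝ) → ℝ), IsLip φ →
    Integrable (fun y : ℕ → ℝ => φ (fun i => y i)) Q ∧
      ∫ y, φ (fun i => y i) ∂Q ≤ S.E (fun ω => φ (fun i => X i ω))}

end SublinearExpectationSpace

/-- The iterated integral `∫ κ₀(dx₀) ∫ κ₁(x₀, dx₁) ⋯ ∫ f(x₀, …, xₙ₋₁) κₙ₋₁(x₀, …, xₙ₋₂, dxₙ₋₁)`.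
Here `κ 0` has a one-point source, so it is just a measure on `ℝ`. -/
noncomputable def iterLIntegral (κ : (n : ℕ) → Kernel (Fin n → ℝ) ℝ) :
    (n : ℕ) → ((Fin n → ℝ) → ℝ≥0∞) → ℝ≥0∞
  | 0, f => f (fun i => i.elim0)
  | n + 1, f => iterLIntegral κ n
      (fun x => ∫⁻ y, f (Fin.snoc (α := fun _ => ℝ) x y) ∂(κ n x))

/-- The set of laws on `ℝ^ℕ` generated by probability kernels: `κ n (x₀, …, xₙ₋₁)` lies in `M n`
for every `(x₀, …, xₙ₋₁)`, and the finite-dimensional laws are the iterated integrals. -/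
def kernelLaws (M : ℕ → Set (Measure ℝ)) : Set (Measure (ℕ → ℝ)) :=
  {Q | IsProbabilityMeasure Q ∧ ∃ κ : (n : ℕ) → Kernel (Fin n → ℝ) ℝ,
    (∀ n, IsMarkovKernel (κ n)) ∧ (∀ n x, κ n x ∈ M n) ∧
      ∀ (n : ℕ) (A : Set (Fin n → ℝ)), MeasurableSet A →
        Q {y | (fun i : Fin n => y i) ∈ A} = iterLIntegral κ n (A.indicator 1)}

/-- The upper expectation `sup_{P ∈ M} E_P[f]` of a set of measures. -/
noncomputable def upperExpectation {α : Type*} {m : MeasurableSpace α} (M : Set (Measure α))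
    (f : α → ℝ) : ℝ :=
  sSup ((fun P : Measure α => ∫ a, f a ∂P) '' M)

/-- The enlargement of `E` from `H` to `σ(H)`-measurable functions: `sup_{P ∈ P_*} E_P[Z]`. -/
noncomputable def SublinearExpectationSpace.extE {Ω : Type*} (S : SublinearExpectationSpace Ω)
    (Z : Ω → ℝ) : ℝ :=
  upperExpectation S.dominatedMeasures Z

/-!
The three sets of laws are compared through `Q_max`.

*Representation.* A linear functional dominated by a regular `E` on `H` is positive, normalised and
continuous along sequences decreasing to `0`, so it is a Daniell integral and is integration against
a probability measure on `σ(H)` (`IsDaniell.integral_eq`; the measure is obtained by Carathéodory's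
method from the upper integral). With the Hahn–Banach theorem this gives
`exists_dominatedMeasure`: a functional dominated by `E` on a part of `H` is represented by a
measure in `P_*`. On the line spanned by `Z` it yields `E[Z] = max_{P ∈ P_*} E_P[Z]`; on the
cylinder functions of `X` it lifts each law in `Q_max` to a measure in `P_*`, which is the inclusion
`Q_max ⊆ P_* ∘ X⁻¹`. The reverse inclusion is immediate.

*Kernel laws are maximal.* For bounded Lipschitz functions, the last variable is integrated out by
the kernel on one side and by the independence of `X n` of the past on the other
(`integral_kernelLaw_le`). Regularity makes the tails of elements of `H` negligible, so the
inequality extends to all Lipschitz functions (`integrable_and_integral_le`).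

*Maximal laws are kernel laws.* A law `Q ∈ Q_max` is disintegrated by regular conditional laws. For
`f ≥ 0` bounded Lipschitz in the past and `ψ` bounded Lipschitz, independence gives
`E[f(X₀, …, Xₙ₋₁) (ψ(Xₙ) - E[ψ(X₀)])] = 0`, hence `E_Q[f(Y₀, …, Yₙ₋₁) (ψ(Yₙ) - E[ψ(X₀)])] ≤ 0`,
and as `f` varies the conditional mean of `ψ` is almost surely at most `E[ψ(X₀)]`. Membership in the
marginal set is decided by countably many `ψ`, because for each `N` the Lipschitz functions bounded
by `N` are separable for uniform convergence on compact sets (`mem_marginalLaws_of_denseSeq`). So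
the conditional laws belong to the marginal set almost surely, and are redefined on a null set.

The final formula is the change of variables `P ↦ P ∘ X⁻¹` applied to the equality of the sets.
-/

/-! ### The Daniell integral -/

section Daniell

variable {Ω : Type*}

/-- A linear functional `L` on functions whose restriction to the vector lattice `V ∋ 1` is a
normalised Daniell integral. The functional is written as total for convenience, only its values
on `V` are constrained. -/
structure IsDaniell (V : Submodule ℝ (Ω → ℝ)) (L : (Ω → ℝ) →ₗ[ℝ] ℝ) : Prop where
  sup_mem : ∀ f ∈ V, ∀ g ∈ V, (fun ω => max (f ω) (g ω)) ∈ V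
  one_mem : (fun _ => (1 : ℝ)) ∈ V
  nonneg : ∀ f ∈ V, (∀ ω, 0 ≤ f ω) → 0 ≤ L f
  one : L (fun _ => (1 : ℝ)) = 1
  regular : ∀ Z : ℕ → Ω → ℝ, (∀ i, Z i ∈ V) → (∀ ω, Antitone (fun i => Z i ω)) →
    (∀ ω, Tendsto (fun i => Z i ω) atTop (𝓝 0)) → Tendsto (fun i => L (Z i)) atTop (𝓝 0)

/-- `f` is a sequence of nonnegative elements of `V` whose sum is at least `1` on `A`. -/
def IsDaniellCover (V : Submodule ℝ (Ω → ℝ)) (A : Set Ω) (f : ℕ → Ω → ℝ) : Prop :=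
  (∀ k, f k ∈ V) ∧ (∀ k ω, 0 ≤ f k ω) ∧ ∀ ω ∈ A, 1 ≤ ∑' k, ENNReal.ofReal (f k ω)

/-- The upper integral of the indicator function of `A`: the infimum of `∑ L (f k)` over the
sequences of nonnegative `f k ∈ V` with `1_A ≤ ∑ f k`. -/
noncomputable def daniellOuter (V : Submodule ℝ (Ω → ℝ)) (L : (Ω → ℝ) →ₗ[ℝ] ℝ) (A : Set Ω) :
    ℝ≥0∞ :=
  ⨅ (f : ℕ → Ω → ℝ) (_ : IsDaniellCover V A f), ∑' k, ENNReal.ofReal (L (f k))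

variable {V : Submodule ℝ (Ω → ℝ)} {L : (Ω → ℝ) →ₗ[ℝ] ℝ}

theorem daniellOuter_mono {A B : Set Ω} (h : A ⊆ B) : daniellOuter V L A ≤ daniellOuter V L B :=
  le_iInf₂ fun f hf => iInf₂_le f ⟨hf.1, hf.2.1, fun ω hω => hf.2.2 ω (h hω)⟩

theorem daniellOuter_le {A : Set Ω} {f : ℕ → Ω → ℝ} (hf : IsDaniellCover V A f) :
    daniellOuter V L A ≤ ∑' k, ENNReal.ofReal (L (f k)) :=
  iInf₂_le f hf

theorem daniellOuter_le_tsum_tsum {A : Set Ω} {f : ℕ → ℕ → Ω → ℝ} (hV : ∀ i k, f i k ∈ V)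
    (h0 : ∀ i k ω, 0 ≤ f i k ω) (h1 : ∀ ω ∈ A, 1 ≤ ∑' i, ∑' k, ENNReal.ofReal (f i k ω)) :
    daniellOuter V L A ≤ ∑' i, ∑' k, ENNReal.ofReal (L (f i k)) := by
  have key : ∀ u : ℕ → ℕ → ℝ≥0∞, ∑' i, ∑' k, u i k = ∑' n : ℕ, u n.unpair.1 n.unpair.2 := by
    intro u
    rw [← ENNReal.tsum_prod (f := u), ← Nat.pairEquiv.symm.tsum_eq]
    rfl
  rw [key]
  refine daniellOuter_le ⟨fun n => hV _ _, fun n ω => h0 _ _ _, fun ω hω => ?_⟩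
  rw [← key (fun i k => ENNReal.ofReal (f i k ω))]
  exact h1 ω hω

theorem daniellOuter_iUnion_le (s : ℕ → Set Ω) :
    daniellOuter V L (⋃ i, s i) ≤ ∑' i, daniellOuter V L (s i) := by
  refine ENNReal.le_of_forall_pos_le_add fun ε hε hfin => ?_
  obtain ⟨δ, hδ, hδε⟩ := ENNReal.exists_pos_sum_of_countable (ENNReal.coe_ne_zero.2 hε.ne') ℕ
  have hex : ∀ i, ∃ f, IsDaniellCover V (s i) f ∧
      ∑' k, ENNReal.ofReal (L (f k)) < daniellOuter V L (s i) + δ i := by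
    intro i
    have hlt : daniellOuter V L (s i) < daniellOuter V L (s i) + δ i :=
      ENNReal.lt_add_right (ENNReal.ne_top_of_tsum_ne_top hfin.ne i)
        (ENNReal.coe_ne_zero.2 (hδ i).ne')
    nth_rewrite 1 [daniellOuter] at hlt
    simpa [iInf_lt_iff] using hlt
  choose f hf hfl using hex
  calc daniellOuter V L (⋃ i, s i) ≤ ∑' i, ∑' k, ENNReal.ofReal (L (f i k)) := by
        refine daniellOuter_le_tsum_tsum (fun i => (hf i).1) (fun i => (hf i).2.1) fun ω hω => ?_
        obtain ⟨i, hi⟩ := Set.mem_iUnion.1 hω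
        exact ((hf i).2.2 ω hi).trans
          (ENNReal.le_tsum (f := fun i => ∑' k, ENNReal.ofReal (f i k ω)) i)
    _ ≤ ∑' i, (daniellOuter V L (s i) + δ i) := ENNReal.tsum_le_tsum fun i => (hfl i).le
    _ = ∑' i, daniellOuter V L (s i) + ∑' i, (δ i : ℝ≥0∞) := ENNReal.tsum_add
    _ ≤ ∑' i, daniellOuter V L (s i) + ε := by gcongr

namespace IsDaniell

variable (h : IsDaniell V L)
include h

theorem const_mem (c : ℝ) : (fun _ => c) ∈ V := by
  have := V.smul_mem c h.one_mem
  simpa [Pi.smul_def] using this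

theorem map_const (c : ℝ) : L (fun _ => c) = c := by
  have := L.map_smul c (fun _ => (1 : ℝ))
  rw [h.one] at this
  simpa [Pi.smul_def] using this

theorem inf_mem {f g : Ω → ℝ} (hf : f ∈ V) (hg : g ∈ V) : (fun ω => min (f ω) (g ω)) ∈ V := by
  have := V.neg_mem (h.sup_mem _ (V.neg_mem hf) _ (V.neg_mem hg))
  convert this using 2 with ω
  simp [max_neg_neg]

theorem mono {f g : Ω → ℝ} (hf : f ∈ V) (hg : g ∈ V) (hfg : ∀ ω, f ω ≤ g ω) : L f ≤ L g := by
  have := h.nonneg (g - f) (V.sub_mem hg hf) (fun ω => sub_nonneg.2 (hfg ω))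
  rw [map_sub] at this
  linarith

/-- Countable subadditivity of `L`; this is where the continuity of `L` along decreasing sequences
enters. -/
theorem ofReal_le_tsum {f : Ω → ℝ} (hf : f ∈ V) {g : ℕ → Ω → ℝ} (hg : ∀ k, g k ∈ V)
    (hg0 : ∀ k ω, 0 ≤ g k ω)
    (hfg : ∀ ω, ENNReal.ofReal (f ω) ≤ ∑' k, ENNReal.ofReal (g k ω)) :
    ENNReal.ofReal (L f) ≤ ∑' k, ENNReal.ofReal (L (g k)) := by
  have hS : ∀ n, (∑ k ∈ Finset.range n, g k) ∈ V := fun n => V.sum_mem fun k _ => hg k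
  set r : ℕ → Ω → ℝ := fun n ω => max (f ω - (∑ k ∈ Finset.range n, g k) ω) 0 with hr
  have hrV : ∀ n, r n ∈ V := fun n =>
    h.sup_mem _ (V.sub_mem hf (hS n)) _ (h.const_mem 0)
  have hr0 : Tendsto (fun n => L (r n)) atTop (𝓝 0) := by
    refine h.regular r hrV (fun ω => ?_) (fun ω => ?_)
    · refine antitone_nat_of_succ_le fun n => ?_
      simp only [hr, Finset.sum_range_succ, Pi.add_apply]
      have := hg0 n ω
      gcongr
      linarith
    · have h1 : ∀ n, r n ω = (ENNReal.ofReal (f ω) -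
          ∑ k ∈ Finset.range n, ENNReal.ofReal (g k ω)).toReal := by
        intro n
        rw [← ENNReal.ofReal_sum_of_nonneg fun k _ => hg0 k ω,
          ← ENNReal.ofReal_sub _ (Finset.sum_nonneg fun k _ => hg0 k ω), ENNReal.toReal_ofReal']
        simp [hr]
      have h2 : Tendsto (fun n => ENNReal.ofReal (f ω) -
          ∑ k ∈ Finset.range n, ENNReal.ofReal (g k ω)) atTop (𝓝 0) := by
        rw [← tsub_eq_zero_of_le (hfg ω)]
        exact ENNReal.Tendsto.sub tendsto_const_nhds (ENNReal.tendsto_nat_tsum _)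
          (Or.inl ENNReal.ofReal_ne_top)
      simp only [h1]
      simpa [Function.comp_def] using (ENNReal.tendsto_toReal ENNReal.zero_ne_top).comp h2
  have hle : ∀ n, ENNReal.ofReal (L f) ≤
      ENNReal.ofReal (L (r n)) + ∑' k, ENNReal.ofReal (L (g k)) := by
    intro n
    have : L f ≤ L (r n) + ∑ k ∈ Finset.range n, L (g k) := by
      rw [← map_sum, ← map_add]
      refine h.mono hf (V.add_mem (hrV n) (hS n)) fun ω => ?_
      have := le_max_left (f ω - (∑ k ∈ Finset.range n, g k) ω) 0
      simp only [hr, Pi.add_apply]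
      linarith
    refine (ENNReal.ofReal_le_ofReal this).trans (ENNReal.ofReal_add_le.trans ?_)
    gcongr
    rw [ENNReal.ofReal_sum_of_nonneg fun k _ => h.nonneg _ (hg k) (hg0 k)]
    exact ENNReal.sum_le_tsum _
  have hlim : Tendsto (fun n => ENNReal.ofReal (L (r n)) + ∑' k, ENNReal.ofReal (L (g k))) atTop
      (𝓝 (0 + ∑' k, ENNReal.ofReal (L (g k)))) :=
    Tendsto.add (by simpa [Function.comp_def] using (ENNReal.continuous_ofReal.tendsto 0).comp hr0)
      tendsto_const_nhds
  simpa using ge_of_tendsto' hlim hle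

theorem daniellOuter_empty : daniellOuter V L ∅ = 0 := by
  refine le_antisymm ((daniellOuter_le (f := fun _ _ => 0)
    ⟨fun _ => h.const_mem 0, by simp, by simp⟩).trans ?_) zero_le
  simp [h.map_const]

/-- The outer measure attached to a Daniell integral. -/
noncomputable def outerMeasure : OuterMeasure Ω where
  measureOf := daniellOuter V L
  empty := h.daniellOuter_empty
  mono := daniellOuter_mono
  iUnion_nat := fun s _ => daniellOuter_iUnion_le s

/-- The sets `{c < Z}` with `Z ∈ V` are Carathéodory measurable: a cover `∑ f k` of `t` is split
by means of `min (f k) (m (Z - c)⁺)`, which increases to `f k` on `{c < Z}` and vanishes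
elsewhere. -/
theorem isCaratheodory_lt {Z : Ω → ℝ} (hZ : Z ∈ V) (c : ℝ) :
    MeasurableSet[h.outerMeasure.caratheodory] {ω | c < Z ω} := by
  rw [OuterMeasure.isCaratheodory_iff_le]
  intro t
  change daniellOuter V L _ + daniellOuter V L _ ≤ daniellOuter V L t
  refine le_iInf₂ fun f hf => ?_
  obtain ⟨hfV, hf0, hf1⟩ := hf
  set g : ℕ → ℕ → Ω → ℝ := fun k m ω => min (f k ω) (m * max (Z ω - c) 0) with hg
  have hgV : ∀ k m, g k m ∈ V := fun k m => h.inf_mem (hfV k)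
    (V.smul_mem (m : ℝ) (h.sup_mem _ (V.sub_mem hZ (h.const_mem c)) _ (h.const_mem 0)))
  have hgmono : ∀ k ω, Monotone fun m => g k m ω := by
    intro k ω m m' hmm
    simp only [hg]
    gcongr
  have hg00 : ∀ k, g k 0 = 0 := by
    intro k; ext ω; simpa [hg] using hf0 k ω
  have hgle : ∀ k m ω, g k m ω ≤ f k ω := fun k m ω => min_le_left _ _
  have hinc0 : ∀ k m ω, 0 ≤ (g k (m + 1) - g k m) ω := fun k m ω =>
    sub_nonneg.2 (hgmono k ω m.le_succ)
  have hgg : ∀ k m ω, 0 ≤ g k m ω := fun k m ω => by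
    simpa [hg00] using hgmono k ω (Nat.zero_le m)
  have htel : ∀ (k M : ℕ) ω, ∑ m ∈ Finset.range M, ENNReal.ofReal ((g k (m + 1) - g k m) ω) =
      ENNReal.ofReal (g k M ω) := by
    intro k M ω
    rw [← ENNReal.ofReal_sum_of_nonneg fun m _ => hinc0 k m ω]
    congr 1
    simp only [Pi.sub_apply]
    rw [Finset.sum_range_sub (fun m => g k m ω)]
    simp [hg00]
  have htelL : ∀ (k M : ℕ), ∑ m ∈ Finset.range M, ENNReal.ofReal (L (g k (m + 1) - g k m)) =
      ENNReal.ofReal (L (g k M)) := by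
    intro k M
    rw [← ENNReal.ofReal_sum_of_nonneg fun m _ =>
      h.nonneg _ (V.sub_mem (hgV _ _) (hgV _ _)) (hinc0 k m), ← map_sum]
    congr 2
    rw [Finset.sum_range_sub (fun m => g k m)]
    simp [hg00]
  have hin : daniellOuter V L (t ∩ {ω | c < Z ω}) ≤
      ∑' k, ∑' m, ENNReal.ofReal (L (g k (m + 1) - g k m)) := by
    refine daniellOuter_le_tsum_tsum (fun k m => V.sub_mem (hgV _ _) (hgV _ _)) hinc0 ?_
    rintro ω ⟨hωt, hωZ⟩
    refine (hf1 ω hωt).trans (ENNReal.tsum_le_tsum fun k => ?_)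
    have hpos : 0 < Z ω - c := sub_pos.2 hωZ
    obtain ⟨M, hM⟩ := exists_nat_ge (f k ω / (Z ω - c))
    have : g k M ω = f k ω := by
      refine min_eq_left ?_
      rw [max_eq_left hpos.le]
      exact (div_le_iff₀ hpos).1 hM
    rw [← this, ← htel k M ω]
    exact ENNReal.sum_le_tsum _
  have hout : daniellOuter V L (t \ {ω | c < Z ω}) ≤
      ∑' k, ⨅ m, ENNReal.ofReal (L (f k - g k m)) := by
    refine ENNReal.le_of_forall_pos_le_add fun ε hε hfin => ?_
    obtain ⟨δ, hδ, hδε⟩ := ENNReal.exists_pos_sum_of_countable (ENNReal.coe_ne_zero.2 hε.ne') ℕ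
    have hex : ∀ k, ∃ m, ENNReal.ofReal (L (f k - g k m)) <
        (⨅ m, ENNReal.ofReal (L (f k - g k m))) + δ k := fun k =>
      iInf_lt_iff.1 (ENNReal.lt_add_right (ENNReal.ne_top_of_tsum_ne_top hfin.ne k)
        (ENNReal.coe_ne_zero.2 (hδ k).ne'))
    choose m hm using hex
    calc daniellOuter V L (t \ {ω | c < Z ω}) ≤ ∑' k, ENNReal.ofReal (L (f k - g k (m k))) := by
          refine daniellOuter_le ⟨fun k => V.sub_mem (hfV k) (hgV _ _),
            fun k ω => sub_nonneg.2 (hgle _ _ _), ?_⟩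
          rintro ω ⟨hωt, hωZ⟩
          refine (hf1 ω hωt).trans (ENNReal.tsum_le_tsum fun k => ENNReal.ofReal_le_ofReal ?_)
          have : Z ω - c ≤ 0 := sub_nonpos.2 (not_lt.1 hωZ)
          simp [hg, max_eq_right this, hf0 k ω]
      _ ≤ ∑' k, ((⨅ m, ENNReal.ofReal (L (f k - g k m))) + δ k) :=
          ENNReal.tsum_le_tsum fun k => (hm k).le
      _ = (∑' k, ⨅ m, ENNReal.ofReal (L (f k - g k m))) + ∑' k, (δ k : ℝ≥0∞) := ENNReal.tsum_add
      _ ≤ (∑' k, ⨅ m, ENNReal.ofReal (L (f k - g k m))) + ε := by gcongr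
  refine (add_le_add hin hout).trans ?_
  rw [← ENNReal.tsum_add]
  refine ENNReal.tsum_le_tsum fun k => ?_
  rw [ENNReal.tsum_eq_iSup_nat, ENNReal.iSup_add]
  refine iSup_le fun M => ?_
  rw [htelL]
  calc ENNReal.ofReal (L (g k M)) + ⨅ m, ENNReal.ofReal (L (f k - g k m))
      ≤ ENNReal.ofReal (L (g k M)) + ENNReal.ofReal (L (f k - g k M)) := by
        gcongr; exact iInf_le _ M
    _ = ENNReal.ofReal (L (f k)) := by
        rw [← ENNReal.ofReal_add (h.nonneg _ (hgV _ _) (hgg k M))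
          (h.nonneg _ (V.sub_mem (hfV k) (hgV _ _)) fun ω => sub_nonneg.2 (hgle _ _ _)), ← map_add]
        simp

omit h in
/-- The σ-algebra generated by `V`. -/
abbrev generatedSigma (V : Submodule ℝ (Ω → ℝ)) : MeasurableSpace Ω :=
  ⨆ Z ∈ V, MeasurableSpace.comap Z (borel ℝ)

theorem generatedSigma_le : generatedSigma V ≤ h.outerMeasure.caratheodory := by
  refine iSup₂_le fun Z hZ => ?_
  rw [borel_eq_generateFrom_Ioi, MeasurableSpace.comap_generateFrom]
  refine MeasurableSpace.generateFrom_le ?_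
  rintro _ ⟨_, ⟨c, rfl⟩, rfl⟩
  exact h.isCaratheodory_lt hZ c

omit h in
theorem measurable_generatedSigma {Z : Ω → ℝ} (hZ : Z ∈ V) : Measurable[generatedSigma V] Z :=
  (measurable_iff_comap_le (m₁ := generatedSigma V)).2
    (le_iSup₂_of_le (f := fun Z (_ : Z ∈ V) => MeasurableSpace.comap Z (borel ℝ)) Z hZ le_rfl)

/-- The measure on the σ-algebra generated by `V` attached to a Daniell integral. -/
noncomputable def measure : @Measure Ω (generatedSigma V) :=
  @OuterMeasure.toMeasure Ω (generatedSigma V) h.outerMeasure h.generatedSigma_le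

theorem measure_apply {A : Set Ω} (hA : MeasurableSet[generatedSigma V] A) :
    h.measure A = daniellOuter V L A :=
  @toMeasure_apply Ω (generatedSigma V) h.outerMeasure h.generatedSigma_le A hA

theorem mul_measure_le {A : Set Ω} (hA : MeasurableSet[generatedSigma V] A) {f : Ω → ℝ}
    (hf : f ∈ V) (hf0 : ∀ ω, 0 ≤ f ω) {δ : ℝ} (hδ : 0 < δ) (hfA : ∀ ω ∈ A, δ ≤ f ω) :
    ENNReal.ofReal δ * h.measure A ≤ ENNReal.ofReal (L f) := by
  have key : h.measure A ≤ ENNReal.ofReal (L (δ⁻¹ • f)) := by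
    rw [h.measure_apply hA]
    refine (daniellOuter_le (f := fun k => if k = 0 then δ⁻¹ • f else 0) ⟨?_, ?_, ?_⟩).trans ?_
    · intro k
      beta_reduce
      split_ifs
      exacts [V.smul_mem _ hf, V.zero_mem]
    · intro k ω
      beta_reduce
      split_ifs
      · have := hf0 ω
        simp only [Pi.smul_apply, smul_eq_mul]
        positivity
      · simp
    · intro ω hω
      refine le_trans ?_ (ENNReal.le_tsum 0)
      have := hfA ω hω
      simp only [if_true, Pi.smul_apply, smul_eq_mul, ENNReal.one_le_ofReal]
      rw [← inv_mul_cancel₀ hδ.ne']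
      gcongr
    · rw [tsum_eq_single 0 fun k hk => by simp [hk]]
      simp
  calc ENNReal.ofReal δ * h.measure A ≤ ENNReal.ofReal δ * ENNReal.ofReal (L (δ⁻¹ • f)) := by
        gcongr
    _ = ENNReal.ofReal (L f) := by
        rw [← ENNReal.ofReal_mul hδ.le, map_smul, smul_eq_mul, mul_inv_cancel_left₀ hδ.ne']

theorem isProbabilityMeasure : IsProbabilityMeasure h.measure := by
  refine ⟨le_antisymm ?_ ?_⟩
  · simpa [h.one] using h.mul_measure_le (@MeasurableSet.univ Ω (generatedSigma V)) h.one_mem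
      (by simp) one_pos (by simp)
  · rw [h.measure_apply (@MeasurableSet.univ Ω (generatedSigma V))]
    refine le_iInf₂ fun f hf => ?_
    have := h.ofReal_le_tsum h.one_mem hf.1 hf.2.1 fun ω => by simpa using hf.2.2 ω trivial
    simpa [h.one] using this

/-- One half of the representation. The function `f` is cut into the layers
`min f ((j + 1) δ) - min f (j δ)`, and each layer is at most `δ` times the indicator function of
`{j δ < f}`, which is at most the layer below. -/
theorem lintegral_ofReal_le {f : Ω → ℝ} (hf : f ∈ V) (hf0 : ∀ ω, 0 ≤ f ω) :
    ∫⁻ ω, ENNReal.ofReal (f ω) ∂h.measure ≤ ENNReal.ofReal (L f) := by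
  have := h.isProbabilityMeasure
  let _ : MeasurableSpace Ω := generatedSigma V
  have hmeas : ∀ {g : Ω → ℝ}, g ∈ V → Measurable g := fun hg => measurable_generatedSigma hg
  refine ENNReal.le_of_forall_pos_le_add fun δ hδ _ => ?_
  have hδ' : (0 : ℝ) < δ := hδ
  set u : ℕ → Ω → ℝ := fun j ω => min (f ω) (j * δ) with hu
  have huV : ∀ j, u j ∈ V := fun j => h.inf_mem hf (h.const_mem _)
  have hu0 : u 0 = 0 := by ext ω; simpa [hu] using hf0 ω
  have humono : ∀ ω, Monotone fun j => u j ω := by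
    intro ω i j hij
    simp only [hu]
    gcongr
  have hlayer0 : ∀ j ω, 0 ≤ (u (j + 1) - u j) ω := fun j ω => sub_nonneg.2 (humono ω j.le_succ)
  have hlayerδ : ∀ j ω, (u (j + 1) - u j) ω ≤ δ := by
    intro j ω
    simp only [hu, Pi.sub_apply, Nat.cast_add, Nat.cast_one, add_mul, one_mul]
    rcases le_total (f ω) (j * δ) with h1 | h1
    · rw [min_eq_left h1]
      have := min_le_left (f ω) (j * δ + δ)
      linarith
    · rw [min_eq_right h1]
      have := min_le_right (f ω) (j * δ + δ)
      linarith
  have hstep : ∀ j, ∫⁻ ω, ENNReal.ofReal ((u (j + 2) - u (j + 1)) ω) ∂h.measure ≤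
      ENNReal.ofReal (L (u (j + 1) - u j)) := by
    intro j
    have hA : MeasurableSet {ω | ((j + 1 : ℕ) : ℝ) * δ < f ω} :=
      measurableSet_lt measurable_const (hmeas hf)
    calc ∫⁻ ω, ENNReal.ofReal ((u (j + 2) - u (j + 1)) ω) ∂h.measure
        ≤ ∫⁻ ω, {ω | ((j + 1 : ℕ) : ℝ) * δ < f ω}.indicator (fun _ => ENNReal.ofReal δ) ω
            ∂h.measure := by
          refine lintegral_mono fun ω => ?_
          by_cases hω : ((j + 1 : ℕ) : ℝ) * δ < f ω
          · simp only [Set.indicator, Set.mem_ofPred_eq, hω, if_true]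
            exact ENNReal.ofReal_le_ofReal (hlayerδ (j + 1) ω)
          · have h1 : f ω ≤ ((j + 1 : ℕ) : ℝ) * δ := not_lt.1 hω
            have h2 : f ω ≤ ((j + 2 : ℕ) : ℝ) * δ := h1.trans (by gcongr; omega)
            simp only [hu, Pi.sub_apply, min_eq_left h1, min_eq_left h2, sub_self,
              ENNReal.ofReal_zero, zero_le]
      _ = ENNReal.ofReal δ * h.measure {ω | ((j + 1 : ℕ) : ℝ) * δ < f ω} :=
          lintegral_indicator_const hA _
      _ ≤ ENNReal.ofReal (L (u (j + 1) - u j)) := by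
          refine h.mul_measure_le hA (V.sub_mem (huV _) (huV _)) (hlayer0 j) hδ' fun ω hω => ?_
          have h1 : ((j + 1 : ℕ) : ℝ) * δ < f ω := hω
          have h2 : (j : ℝ) * δ ≤ f ω := le_trans (by gcongr; omega) h1.le
          simp only [hu, Pi.sub_apply, min_eq_right h1.le, min_eq_right h2]
          push_cast
          linarith
  have hbound : ∀ N, ∫⁻ ω, ENNReal.ofReal (u N ω) ∂h.measure ≤ ENNReal.ofReal (L f) + δ := by
    have hind : ∀ N, ∫⁻ ω, ENNReal.ofReal (u (N + 1) ω) ∂h.measure ≤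
        ENNReal.ofReal (L (u N)) + δ := by
      intro N
      induction N with
      | zero =>
        calc ∫⁻ ω, ENNReal.ofReal (u (0 + 1) ω) ∂h.measure
            ≤ ∫⁻ _, ENNReal.ofReal δ ∂h.measure := by
              refine lintegral_mono fun ω => ENNReal.ofReal_le_ofReal ?_
              simp [hu]
          _ ≤ ENNReal.ofReal (L (u 0)) + δ := by simp
      | succ N ih =>
        have e1 : ∀ ω, ENNReal.ofReal (u (N + 1 + 1) ω) =
            ENNReal.ofReal (u (N + 1) ω) + ENNReal.ofReal ((u (N + 2) - u (N + 1)) ω) := by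
          intro ω
          rw [← ENNReal.ofReal_add _ (hlayer0 _ ω)]
          · simp
          · simpa [hu0] using humono ω (Nat.zero_le (N + 1))
        have e2 : ENNReal.ofReal (L (u (N + 1))) =
            ENNReal.ofReal (L (u N)) + ENNReal.ofReal (L (u (N + 1) - u N)) := by
          rw [← ENNReal.ofReal_add _ (h.nonneg _ (V.sub_mem (huV _) (huV _)) (hlayer0 N)),
            ← map_add]
          · simp
          · exact h.nonneg _ (huV _) fun ω => by simpa [hu0] using humono ω (Nat.zero_le N)
        simp only [e1]
        rw [lintegral_add_left (hmeas (huV _)).ennreal_ofReal, e2, add_right_comm]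
        exact add_le_add ih (hstep N)
    intro N
    calc ∫⁻ ω, ENNReal.ofReal (u N ω) ∂h.measure
        ≤ ∫⁻ ω, ENNReal.ofReal (u (N + 1) ω) ∂h.measure :=
          lintegral_mono fun ω => ENNReal.ofReal_le_ofReal (humono ω N.le_succ)
      _ ≤ ENNReal.ofReal (L (u N)) + δ := hind N
      _ ≤ ENNReal.ofReal (L f) + δ := by
          gcongr
          exact h.mono (huV N) hf fun ω => min_le_left _ _
  calc ∫⁻ ω, ENNReal.ofReal (f ω) ∂h.measure
      ≤ ∫⁻ ω, ⨆ N, ENNReal.ofReal (u N ω) ∂h.measure := by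
        refine lintegral_mono fun ω => ?_
        obtain ⟨N, hN⟩ := exists_nat_ge (f ω / δ)
        refine le_iSup_of_le N (le_of_eq ?_)
        rw [hu]
        simp only
        rw [min_eq_left ((div_le_iff₀ hδ').1 hN)]
    _ = ⨆ N, ∫⁻ ω, ENNReal.ofReal (u N ω) ∂h.measure :=
        lintegral_iSup (fun N => (hmeas (huV N)).ennreal_ofReal)
          fun i j hij ω => ENNReal.ofReal_le_ofReal (humono ω hij)
    _ ≤ ENNReal.ofReal (L f) + δ := iSup_le hbound

theorem integrable {f : Ω → ℝ} (hf : f ∈ V) : Integrable f h.measure := by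
  refine ⟨(measurable_generatedSigma hf).aestronglyMeasurable, ?_⟩
  rw [hasFiniteIntegral_iff_norm]
  have hab : (fun ω => |f ω|) ∈ V := h.sup_mem _ hf _ (V.neg_mem hf)
  exact (h.lintegral_ofReal_le hab fun ω => abs_nonneg _).trans_lt ENNReal.ofReal_lt_top

theorem integral_le {f : Ω → ℝ} (hf : f ∈ V) : ∫ ω, f ω ∂h.measure ≤ L f := by
  have := h.isProbabilityMeasure
  have hbelow : ∀ (g : Ω → ℝ) (_ : g ∈ V) (C : ℝ) (_ : ∀ ω, -C ≤ g ω),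
      ∫ ω, g ω ∂h.measure ≤ L g := by
    intro g hg C hC
    have hgC : (fun ω => g ω + C) ∈ V := V.add_mem hg (h.const_mem C)
    have h0 : ∀ ω, 0 ≤ g ω + C := fun ω => by linarith [hC ω]
    have h1 := h.lintegral_ofReal_le hgC h0
    rw [← ofReal_integral_eq_lintegral_ofReal (h.integrable hgC) (Eventually.of_forall h0),
      ENNReal.ofReal_le_ofReal_iff (h.nonneg _ hgC h0),
      integral_add (h.integrable hg) (integrable_const C)] at h1
    have h2 : L (fun ω => g ω + C) = L g + C := by
      have := L.map_add g (fun _ => C)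
      rwa [h.map_const] at this
    rw [h2] at h1
    simpa using h1
  -- A general `f` is the decreasing limit of its truncations from below.
  set r : ℕ → Ω → ℝ := fun N ω => max (f ω) (-(N : ℝ)) with hr
  have hrV : ∀ N, r N ∈ V := fun N => h.sup_mem _ hf _ (h.const_mem _)
  have hlim : Tendsto (fun N => L (r N - f)) atTop (𝓝 0) := by
    refine h.regular (fun N => r N - f) (fun N => V.sub_mem (hrV N) hf) (fun ω => ?_) (fun ω => ?_)
    · intro i j hij
      simp only [hr, Pi.sub_apply]
      gcongr
    · refine tendsto_const_nhds.congr' ?_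
      obtain ⟨N, hN⟩ := exists_nat_ge (-(f ω))
      filter_upwards [eventually_ge_atTop N] with M hM
      have : (N : ℝ) ≤ M := by exact_mod_cast hM
      simp only [hr, Pi.sub_apply]
      rw [max_eq_left (by linarith), sub_self]
  have hle : ∀ N, ∫ ω, f ω ∂h.measure - L f ≤ L (r N - f) := by
    intro N
    have h1 := hbelow (r N) (hrV N) N fun ω => le_max_right _ _
    have h2 : ∫ ω, f ω ∂h.measure ≤ ∫ ω, r N ω ∂h.measure :=
      integral_mono (h.integrable hf) (h.integrable (hrV N)) fun ω => le_max_left _ _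
    rw [map_sub]
    linarith
  linarith [ge_of_tendsto' hlim hle]

/-- The Daniell–Stone representation: `L` is the integral against `h.measure`. -/
theorem integral_eq {f : Ω → ℝ} (hf : f ∈ V) : ∫ ω, f ω ∂h.measure = L f := by
  refine le_antisymm (h.integral_le hf) ?_
  have := h.integral_le (V.neg_mem hf)
  simp only [Pi.neg_apply, integral_neg, map_neg] at this
  linarith

end IsDaniell

end Daniell

/-! ### Representation of a regular sublinear expectation -/

theorem IsLip.comp_reindex {n m : ℕ} {φ : (Fin n → ℝ) → ℝ} (hφ : IsLip φ) (e : Fin n → Fin m) :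
    IsLip (fun x : Fin m → ℝ => φ (fun i => x (e i))) := by
  obtain ⟨K, hK⟩ := hφ
  have he : LipschitzWith 1 (fun (x : Fin m → ℝ) (i : Fin n) => x (e i)) :=
    LipschitzWith.of_dist_le_mul fun x y => by
      rw [NNReal.coe_one, one_mul]
      exact (dist_pi_le_iff dist_nonneg).2 fun i => dist_le_pi_dist x y (e i)
  exact ⟨_, hK.comp he⟩

theorem IsLip.add {n : ℕ} {φ ψ : (Fin n → ℝ) → ℝ} (hφ : IsLip φ) (hψ : IsLip ψ) :
    IsLip (fun x => φ x + ψ x) := by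
  obtain ⟨K, hK⟩ := hφ
  obtain ⟨K', hK'⟩ := hψ
  exact ⟨_, hK.add hK'⟩

theorem IsLip.const_mul {n : ℕ} {φ : (Fin n → ℝ) → ℝ} (hφ : IsLip φ) (c : ℝ) :
    IsLip (fun x => c * φ x) := by
  obtain ⟨K, hK⟩ := hφ
  exact ⟨_, (lipschitzWith_smul c).comp hK⟩

namespace SublinearExpectationSpace

variable {Ω : Type*} {S : SublinearExpectationSpace Ω}

theorem const_mem (c : ℝ) : (fun _ => c) ∈ S.H :=
  S.comp_mem 0 (fun i => i.elim0) (fun i => i.elim0) (fun _ => c) ⟨0, LipschitzWith.const c⟩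

theorem comp_lipschitz_mem {Z : Ω → ℝ} (hZ : Z ∈ S.H) {ψ : ℝ → ℝ} {K : NNReal}
    (hψ : LipschitzWith K ψ) : (fun ω => ψ (Z ω)) ∈ S.H :=
  S.comp_mem 1 (fun _ => Z) (fun _ => hZ) (fun x => ψ (x 0)) ⟨_, hψ.comp (LipschitzWith.eval 0)⟩

theorem max_mem {Y Z : Ω → ℝ} (hY : Y ∈ S.H) (hZ : Z ∈ S.H) :
    (fun ω => max (Y ω) (Z ω)) ∈ S.H :=
  S.comp_mem 2 ![Y, Z] (by simp [Fin.forall_fin_two, hY, hZ]) (fun x => max (x 0) (x 1))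
    ⟨_, (LipschitzWith.eval 0).max (LipschitzWith.eval 1)⟩

theorem isDaniell (hreg : S.Regular) {L : (Ω → ℝ) →ₗ[ℝ] ℝ} (hL : ∀ Z ∈ S.H, L Z ≤ S.E Z) :
    IsDaniell S.H L := by
  have hneg : ∀ f ∈ S.H, (∀ ω, 0 ≤ f ω) → 0 ≤ L f := by
    intro f hf h0
    have h1 := hL _ (S.H.neg_mem hf)
    have h2 := S.mono _ (S.H.neg_mem hf) _ (const_mem 0) fun ω => neg_nonpos.2 (h0 ω)
    rw [S.const] at h2
    rw [map_neg] at h1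
    linarith
  refine ⟨fun f hf g hg => max_mem hf hg, const_mem 1, hneg, ?_, ?_⟩
  · have h1 := hL _ (const_mem 1)
    have h2 := hL _ (const_mem (-1))
    have h3 : L (fun _ => (-1 : ℝ)) = - L (fun _ => (1 : ℝ)) := by
      rw [← map_neg]; rfl
    rw [S.const] at h1 h2
    linarith
  · intro Z hZ hanti hlim
    exact squeeze_zero (fun i => hneg _ (hZ i) fun ω => (hanti ω).le_of_tendsto (hlim ω) i)
      (fun i => hL _ (hZ i)) (hreg Z hZ hanti hlim)

/-- Hahn–Banach followed by the Daniell–Stone representation: a linear functional `ℓ`, dominated by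
`E` along a linear map `T` into `H`, is represented by a measure in `P_*`. -/
theorem exists_dominatedMeasure (hreg : S.Regular) {W : Type*} [AddCommGroup W] [Module ℝ W]
    (T : W →ₗ[ℝ] S.H) (l : W →ₗ[ℝ] ℝ) (hl : ∀ w, l w ≤ S.E (T w)) :
    ∃ P ∈ S.dominatedMeasures, ∀ w, ∫ ω, (T w : Ω → ℝ) ω ∂P = l w := by
  have hker : ∀ w, T w = 0 → l w ≤ 0 := by
    intro w hw
    have h1 := hl w
    have h2 : S.E ((T w : S.H) : Ω → ℝ) = 0 := by
      rw [hw]; exact S.const 0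
    linarith
  have hmem : l ∈ (LinearMap.ker T).dualAnnihilator := by
    rw [Submodule.mem_dualAnnihilator]
    intro w hw
    have hw : T w = 0 := hw
    refine le_antisymm (hker w hw) ?_
    have := hker (-w) (by simp [hw])
    simpa using this
  rw [← LinearMap.range_dualMap_eq_dualAnnihilator_ker] at hmem
  obtain ⟨l₀, rfl⟩ := hmem
  obtain ⟨l₁, hl₁, hl₁E⟩ := exists_extension_of_le_sublinear
    ⟨LinearMap.range T, l₀.comp (LinearMap.range T).subtype⟩ (fun Z => S.E (Z : Ω → ℝ))
    (fun c hc Z => S.pos_homog c hc.le Z Z.2) (fun Y Z => S.subadd Y Y.2 Z Z.2) (by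
      rintro ⟨_, w, rfl⟩
      exact hl w)
  obtain ⟨L, hL⟩ := LinearMap.exists_extend l₁
  have hLl : ∀ Z : S.H, L (Z : Ω → ℝ) = l₁ Z := fun Z => LinearMap.congr_fun hL Z
  have hD := isDaniell hreg (L := L) fun Z hZ => by
    rw [hLl ⟨Z, hZ⟩]
    exact hl₁E ⟨Z, hZ⟩
  refine ⟨hD.measure, ⟨hD.isProbabilityMeasure, fun Z hZ => ⟨hD.integrable hZ, ?_⟩⟩, fun w => ?_⟩
  · rw [hD.integral_eq hZ, hLl ⟨Z, hZ⟩]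
    exact hl₁E ⟨Z, hZ⟩
  · rw [hD.integral_eq (T w).2, hLl]
    exact hl₁ ⟨T w, w, rfl⟩

theorem exists_dominatedMeasure_integral_eq (hreg : S.Regular) {Z : Ω → ℝ} (hZ : Z ∈ S.H) :
    ∃ P ∈ S.dominatedMeasures, ∫ ω, Z ω ∂P = S.E Z := by
  obtain ⟨P, hP, hPZ⟩ := exists_dominatedMeasure hreg
    (LinearMap.toSpanSingleton ℝ S.H ⟨Z, hZ⟩) (LinearMap.toSpanSingleton ℝ ℝ (S.E Z)) fun c => by
      rcases le_total 0 c with hc | hc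
      · exact (S.pos_homog c hc Z hZ).ge
      · have h1 := S.pos_homog (-c) (neg_nonneg.2 hc) Z hZ
        have h2 := S.subadd _ (S.H.smul_mem c hZ) _ (S.H.smul_mem (-c) hZ)
        have h3 : S.E (fun ω => (c • Z) ω + (-c • Z) ω) = 0 := by
          have : (fun ω => (c • Z) ω + (-c • Z) ω) = fun _ => (0 : ℝ) := by
            ext ω; simp
          rw [this, S.const]
        have h4 : S.E (-c • Z) = -c * S.E Z := h1
        rw [h3, h4] at h2
        change c * S.E Z ≤ S.E (c • Z)
        linarith
  exact ⟨P, hP, by simpa using hPZ 1⟩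

theorem extE_eq (hreg : S.Regular) {Z : Ω → ℝ} (hZ : Z ∈ S.H) : S.extE Z = S.E Z := by
  obtain ⟨P, hP, hPZ⟩ := exists_dominatedMeasure_integral_eq hreg hZ
  refine IsGreatest.csSup_eq ⟨⟨P, hP, hPZ⟩, ?_⟩
  rintro _ ⟨P, hP, rfl⟩
  exact (hP.2 Z hZ).2

theorem measurable_of_mem {Z : Ω → ℝ} (hZ : Z ∈ S.H) : Measurable[S.sigmaH] Z :=
  IsDaniell.measurable_generatedSigma hZ

end SublinearExpectationSpace

/-! ### Comparison of measures -/

/-- The restriction of a sequence to its first `n` terms. -/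
def firstTerms (n : ℕ) (y : ℕ → ℝ) : Fin n → ℝ := fun i => y i

theorem measurable_firstTerms (n : ℕ) : Measurable (firstTerms n) :=
  measurable_pi_iff.2 fun i => measurable_pi_apply (i : ℕ)

theorem MeasureTheory.Measure.ext_of_map_firstTerms {Q Q' : Measure (ℕ → ℝ)} [IsFiniteMeasure Q]
    (h : ∀ n, Q.map (firstTerms n) = Q'.map (firstTerms n)) : Q = Q' := by
  refine (IsProjectiveLimit.unique (P := fun I : Finset ℕ => Q.map I.restrict)
    (fun I => rfl) fun I => ?_ : Q = Q')
  beta_reduce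
  obtain ⟨n, hn⟩ := I.exists_nat_subset_range
  have hlt : ∀ i : I, (i : ℕ) < n := fun i => Finset.mem_range.1 (hn i.2)
  have hg : Measurable fun (x : Fin n → ℝ) (i : I) => x ⟨i, hlt i⟩ :=
    measurable_pi_iff.2 fun i => measurable_pi_apply _
  have hcomp : (I.restrict : (ℕ → ℝ) → I → ℝ) =
      (fun (x : Fin n → ℝ) (i : I) => x ⟨i, hlt i⟩) ∘ firstTerms n := rfl
  rw [hcomp, ← Measure.map_map hg (measurable_firstTerms n), ← h n,
    Measure.map_map hg (measurable_firstTerms n)]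

theorem MeasureTheory.Measure.le_of_forall_lipschitz_integral_le {α : Type*} [PseudoEMetricSpace α]
    [MeasurableSpace α] [BorelSpace α] {μ ν : Measure α} [IsFiniteMeasure μ] [IsFiniteMeasure ν]
    (h : ∀ f : α → ℝ, (∃ K : NNReal, LipschitzWith K f) → (∀ x, 0 ≤ f x) → (∀ x, f x ≤ 1) →
      ∫ x, f x ∂μ ≤ ∫ x, f x ∂ν) : μ ≤ ν := by
  have hclosed : ∀ F : Set α, IsClosed F → μ F ≤ ν F := by
    intro F hF
    have hpos : ∀ n : ℕ, (0 : ℝ) < 1 / (n + 1) := fun n => Nat.one_div_pos_of_nat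
    have hμ := tendsto_integral_thickenedIndicator_of_isClosed μ hF hpos
      tendsto_one_div_add_atTop_nhds_zero_nat
    have hν := tendsto_integral_thickenedIndicator_of_isClosed ν hF hpos
      tendsto_one_div_add_atTop_nhds_zero_nat
    have hreal : μ.real F ≤ ν.real F := by
      refine le_of_tendsto_of_tendsto' hμ hν fun n =>
        h _ ?_ (fun x => NNReal.coe_nonneg _) fun x => ?_
      · exact ⟨_, (LipschitzWith.subtype_val _).comp (lipschitzWith_thickenedIndicator (hpos n) F)⟩
      · exact_mod_cast thickenedIndicator_le_one (hpos n) F x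
    exact (ENNReal.toReal_le_toReal (measure_ne_top _ _) (measure_ne_top _ _)).1 hreal
  refine Measure.le_iff.2 fun A hA => ?_
  rw [hA.measure_eq_iSup_isClosed_of_ne_top (measure_ne_top μ A)]
  exact iSup₂_le fun F hFA => iSup_le fun hF => (hclosed F hF).trans (measure_mono hFA)

/-- If the mean of `u` under the disintegration kernel, tested against Lipschitz functions
`0 ≤ f ≤ 1` of the first variable, is at most `c`, then it is almost surely at most `c`. -/
theorem ProbabilityTheory.Kernel.ae_integral_le_of_compProd {α : Type*} [PseudoEMetricSpace α]
    [MeasurableSpace α] [BorelSpace α] {μ : Measure α} [IsFiniteMeasure μ] {κ : Kernel α ℝ}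
    [IsMarkovKernel κ] {u : ℝ → ℝ} (hu : Measurable u) (hu0 : ∀ y, 0 ≤ u y) {B : ℝ}
    (huB : ∀ y, u y ≤ B) {c : ℝ} (hc : 0 ≤ c)
    (h : ∀ f : α → ℝ, (∃ K : NNReal, LipschitzWith K f) → (∀ x, 0 ≤ f x) → (∀ x, f x ≤ 1) →
      ∫ p, f p.1 * u p.2 ∂(μ ⊗ₘ κ) ≤ c * ∫ x, f x ∂μ) :
    ∀ᵐ x ∂μ, ∫ y, u y ∂(κ x) ≤ c := by
  set g : α → ℝ := fun x => ∫ y, u y ∂(κ x) with hg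
  have hgm : Measurable g := (hu.stronglyMeasurable.integral_kernel (κ := κ)).measurable
  have hg0 : ∀ x, 0 ≤ g x := fun x => integral_nonneg hu0
  have hgB : ∀ x, g x ≤ B := fun x => by
    have := integral_mono_of_nonneg (μ := κ x) (Eventually.of_forall hu0) (integrable_const B)
      (Eventually.of_forall huB)
    simpa using this
  have : IsFiniteMeasure (μ.withDensity fun x => ENNReal.ofReal (g x)) := by
    refine isFiniteMeasure_withDensity (ne_of_lt ?_)
    calc ∫⁻ x, ENNReal.ofReal (g x) ∂μ ≤ ∫⁻ _, ENNReal.ofReal B ∂μ :=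
          lintegral_mono fun x => ENNReal.ofReal_le_ofReal (hgB x)
      _ < ∞ := by
          rw [MeasureTheory.lintegral_const]
          exact ENNReal.mul_lt_top ENNReal.ofReal_lt_top (measure_lt_top _ _)
  have : IsFiniteMeasure (ENNReal.ofReal c • μ) := μ.smul_finite ENNReal.ofReal_ne_top
  have hle : μ.withDensity (fun x => ENNReal.ofReal (g x)) ≤ ENNReal.ofReal c • μ := by
    refine Measure.le_of_forall_lipschitz_integral_le fun f hf hf0 hf1 => ?_
    have hfm : Measurable f := hf.choose_spec.continuous.measurable
    have hint : Integrable (fun p : α × ℝ => f p.1 * u p.2) (μ ⊗ₘ κ) := by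
      refine Integrable.of_bound ((hfm.comp measurable_fst).mul
        (hu.comp measurable_snd)).aestronglyMeasurable (1 * B) (Eventually.of_forall fun p => ?_)
      rw [Real.norm_of_nonneg (mul_nonneg (hf0 _) (hu0 _))]
      exact mul_le_mul (hf1 _) (huB _) (hu0 _) zero_le_one
    have h1 := h f hf hf0 hf1
    rw [Measure.integral_compProd hint] at h1
    rw [integral_smul_measure, ENNReal.toReal_ofReal hc, smul_eq_mul,
      integral_withDensity_eq_integral_toReal_smul hgm.ennreal_ofReal
        (Eventually.of_forall fun _ => ENNReal.ofReal_lt_top)]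
    refine le_trans (le_of_eq (integral_congr_ae (Eventually.of_forall fun x => ?_))) h1
    simp only [ENNReal.toReal_ofReal (hg0 x), smul_eq_mul, integral_const_mul]
    exact mul_comm _ _
  have hae : (fun x => ENNReal.ofReal (g x)) ≤ᵐ[μ] fun _ => ENNReal.ofReal c := by
    refine ae_le_of_forall_setLIntegral_le_of_sigmaFinite hgm.ennreal_ofReal fun s hs _ => ?_
    have := hle s
    rw [withDensity_apply _ hs] at this
    simpa using this
  filter_upwards [hae] with x hx
  exact (ENNReal.ofReal_le_ofReal_iff hc).1 hx

/-! ### Laws generated by kernels -/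

theorem measurable_snoc {n : ℕ} :
    Measurable fun p : (Fin n → ℝ) × ℝ => Fin.snoc (α := fun _ => ℝ) p.1 p.2 := by
  refine measurable_pi_iff.2 fun i => ?_
  refine Fin.lastCases ?_ (fun j => ?_) i
  · simpa using measurable_snd
  · simpa [Function.comp_def] using (measurable_pi_apply j).comp measurable_fst

/-- The law on `ℝⁿ` generated by the kernels `κ 0, …, κ (n - 1)`. -/
noncomputable def kernelLaw (κ : (n : ℕ) → Kernel (Fin n → ℝ) ℝ) : (n : ℕ) → Measure (Fin n → ℝ)
  | 0 => Measure.dirac fun i => i.elim0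
  | n + 1 => (kernelLaw κ n ⊗ₘ κ n).map fun p => Fin.snoc (α := fun _ => ℝ) p.1 p.2

section

variable {κ : (n : ℕ) → Kernel (Fin n → ℝ) ℝ} [∀ n, IsMarkovKernel (κ n)]

instance isProbabilityMeasure_kernelLaw (n : ℕ) : IsProbabilityMeasure (kernelLaw κ n) := by
  induction n with
  | zero => exact Measure.dirac.isProbabilityMeasure
  | succ n ih => exact Measure.isProbabilityMeasure_map measurable_snoc.aemeasurable

theorem lintegral_kernelLaw (n : ℕ) {f : (Fin n → ℝ) → ℝ≥0∞} (hf : Measurable f) :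
    ∫⁻ x, f x ∂(kernelLaw κ n) = iterLIntegral κ n f := by
  induction n with
  | zero => exact lintegral_dirac' _ hf
  | succ n ih =>
    have hfs : Measurable fun p : (Fin n → ℝ) × ℝ => f (Fin.snoc (α := fun _ => ℝ) p.1 p.2) :=
      hf.comp measurable_snoc
    rw [kernelLaw, lintegral_map hf measurable_snoc, Measure.lintegral_compProd hfs, iterLIntegral,
      ← ih]
    exact hfs.lintegral_kernel_prod_right'

theorem integral_kernelLaw_succ (n : ℕ) {f : (Fin (n + 1) → ℝ) → ℝ} (hf : Measurable f)
    {C : ℝ} (hC : ∀ x, |f x| ≤ C) :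
    ∫ x, f x ∂(kernelLaw κ (n + 1)) =
      ∫ x, ∫ y, f (Fin.snoc (α := fun _ => ℝ) x y) ∂(κ n x) ∂(kernelLaw κ n) := by
  rw [kernelLaw, integral_map measurable_snoc.aemeasurable hf.aestronglyMeasurable,
    Measure.integral_compProd]
  exact Integrable.of_bound (hf.comp measurable_snoc).aestronglyMeasurable C
    (Eventually.of_forall fun p => hC _)

theorem forall_measure_eq_iterLIntegral_iff {Q : Measure (ℕ → ℝ)} :
    (∀ (n : ℕ) (A : Set (Fin n → ℝ)), MeasurableSet A →
      Q {y | (fun i : Fin n => y i) ∈ A} = iterLIntegral κ n (A.indicator 1)) ↔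
    ∀ n, Q.map (firstTerms n) = kernelLaw κ n := by
  refine forall_congr' fun n => ?_
  rw [Measure.ext_iff]
  refine forall₂_congr fun A hA => ?_
  rw [Measure.map_apply (measurable_firstTerms n) hA,
    ← lintegral_kernelLaw n (measurable_one.indicator hA), lintegral_indicator_one hA]
  rfl

end

/-! ### Passage from bounded to unbounded Lipschitz functions -/

theorem LipschitzWith.abs_real {α : Type*} [PseudoEMetricSpace α] {K : NNReal} {f : α → ℝ}
    (hf : LipschitzWith K f) : LipschitzWith K fun x => |f x| := by
  simpa [Function.comp_def] using lipschitzWith_one_norm.comp hf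

namespace SublinearExpectationSpace

variable {Ω : Type*} {S : SublinearExpectationSpace Ω}

theorem E_le_add_const {Y Z : Ω → ℝ} (hY : Y ∈ S.H) (hZ : Z ∈ S.H) {c : ℝ}
    (h : ∀ ω, Y ω ≤ Z ω + c) : S.E Y ≤ S.E Z + c := by
  have h1 := S.mono Y hY _ (S.H.add_mem hZ (const_mem c)) h
  have h2 := S.subadd Z hZ _ (const_mem c)
  rw [S.const] at h2
  exact h1.trans h2

theorem abs_sub_tail_mem {Z : Ω → ℝ} (hZ : Z ∈ S.H) (c : ℝ) :
    (fun ω => max (|Z ω| - c) 0) ∈ S.H :=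
  comp_lipschitz_mem hZ (ψ := fun t => max (|t| - c) 0)
    ((LipschitzWith.id.abs_real.sub (LipschitzWith.const c)).max (LipschitzWith.const 0))

theorem tendsto_E_tail (hreg : S.Regular) {Z : Ω → ℝ} (hZ : Z ∈ S.H) :
    Tendsto (fun N : ℕ => S.E fun ω => max (|Z ω| - N) 0) atTop (𝓝 0) := by
  refine hreg _ (fun N => abs_sub_tail_mem hZ N) (fun ω i j hij => ?_) fun ω => ?_
  · beta_reduce
    gcongr
  · refine tendsto_const_nhds.congr' ?_
    obtain ⟨N, hN⟩ := exists_nat_ge |Z ω|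
    filter_upwards [eventually_ge_atTop N] with M hM
    have : (N : ℝ) ≤ M := by exact_mod_cast hM
    rw [max_eq_right (by linarith)]

/-- If the law of `φ` under `μ` is dominated by the distribution of `Z` on bounded Lipschitz
functions, then `φ` is integrable with mean at most `E[Z]`. Regularity makes the tails of `Z`
negligible. -/
theorem integrable_and_integral_le (hreg : S.Regular) {α : Type*} [MeasurableSpace α]
    {μ : Measure α} [IsProbabilityMeasure μ] {φ : α → ℝ} (hφ : Measurable φ) {Z : Ω → ℝ}
    (hZ : Z ∈ S.H)
    (hle : ∀ ψ : ℝ → ℝ, (∃ K : NNReal, LipschitzWith K ψ) → (∃ C : ℝ, ∀ x, |ψ x| ≤ C) →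
      ∫ a, ψ (φ a) ∂μ ≤ S.E fun ω => ψ (Z ω)) :
    Integrable φ μ ∧ ∫ a, φ a ∂μ ≤ S.E Z := by
  have habs : (fun ω => |Z ω|) ∈ S.H := comp_lipschitz_mem hZ LipschitzWith.id.abs_real
  have hint : Integrable φ μ := by
    refine ⟨hφ.aestronglyMeasurable, ?_⟩
    rw [hasFiniteIntegral_iff_norm]
    refine lt_of_le_of_lt ?_ (ENNReal.ofReal_lt_top (r := S.E fun ω => |Z ω|))
    have hmeas : ∀ N : ℕ, Measurable fun a => min |φ a| N :=
      fun N => hφ.abs.min measurable_const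
    calc ∫⁻ a, ENNReal.ofReal ‖φ a‖ ∂μ
        ≤ ∫⁻ a, ⨆ N : ℕ, ENNReal.ofReal (min |φ a| N) ∂μ := by
          refine lintegral_mono fun a => ?_
          obtain ⟨N, hN⟩ := exists_nat_ge |φ a|
          exact le_iSup_of_le N (by rw [min_eq_left hN, Real.norm_eq_abs])
      _ = ⨆ N : ℕ, ∫⁻ a, ENNReal.ofReal (min |φ a| N) ∂μ :=
          lintegral_iSup (fun N => (hmeas N).ennreal_ofReal) fun i j hij a =>
            ENNReal.ofReal_le_ofReal (by gcongr)
      _ ≤ ENNReal.ofReal (S.E fun ω => |Z ω|) := by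
          refine iSup_le fun N => ?_
          have h0 : ∀ t : ℝ, 0 ≤ min |t| N := fun t => le_min (abs_nonneg t) N.cast_nonneg
          have hb : ∀ t : ℝ, |min |t| N| ≤ N := fun t => by
            rw [abs_of_nonneg (h0 t)]; exact min_le_right _ _
          have hlip : LipschitzWith (max 1 0) fun t : ℝ => min |t| N :=
            LipschitzWith.id.abs_real.min (LipschitzWith.const _)
          rw [← ofReal_integral_eq_lintegral_ofReal
            (Integrable.of_bound (hmeas N).aestronglyMeasurable N
              (Eventually.of_forall fun a => hb (φ a))) (Eventually.of_forall fun a => h0 (φ a))]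
          refine ENNReal.ofReal_le_ofReal ((hle _ ⟨_, hlip⟩ ⟨N, hb⟩).trans ?_)
          exact S.mono _ (comp_lipschitz_mem hZ hlip) _ habs fun ω => min_le_left _ _
  refine ⟨hint, ?_⟩
  set ψ : ℕ → ℝ → ℝ := fun N t => max (min t N) (-N) with hψ
  have hlip : ∀ N, LipschitzWith (max (max 1 0) 0) (ψ N) := fun N =>
    (LipschitzWith.id.min (LipschitzWith.const _)).max (LipschitzWith.const _)
  have hbd : ∀ N t, |ψ N t| ≤ N := fun N t => by
    have hN : (0 : ℝ) ≤ N := N.cast_nonneg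
    exact abs_le.2 ⟨le_max_right _ _, max_le (min_le_right _ _) (by linarith)⟩
  have hlim : Tendsto (fun N => ∫ a, ψ N (φ a) ∂μ) atTop (𝓝 (∫ a, φ a ∂μ)) := by
    refine tendsto_integral_of_dominated_convergence (fun a => |φ a|)
      (fun N => ((hlip N).continuous.measurable.comp hφ).aestronglyMeasurable) hint.abs
      (fun N => Eventually.of_forall fun a => ?_) (Eventually.of_forall fun a => ?_)
    · have hN : (0 : ℝ) ≤ N := N.cast_nonneg
      rw [Real.norm_eq_abs]
      simp only [hψ]
      rcases max_cases (min (φ a) N) (-(N : ℝ)) with h | h <;>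
        rcases min_cases (φ a) (N : ℝ) with h' | h' <;>
        rcases abs_cases (φ a) with h'' | h'' <;> rw [abs_le] <;> constructor <;> linarith
    · refine tendsto_const_nhds.congr' ?_
      obtain ⟨N, hN⟩ := exists_nat_ge |φ a|
      filter_upwards [eventually_ge_atTop N] with M hM
      have hM : (N : ℝ) ≤ M := by exact_mod_cast hM
      have := abs_le.1 (hN.trans hM)
      simp only [hψ]
      rw [min_eq_left this.2, max_eq_left this.1]
  have hbound : ∀ N : ℕ, ∫ a, ψ N (φ a) ∂μ ≤ S.E Z + S.E fun ω => max (|Z ω| - N) 0 := by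
    intro N
    refine (hle _ ⟨_, hlip N⟩ ⟨N, hbd N⟩).trans ?_
    refine le_trans (S.mono _ (comp_lipschitz_mem hZ (hlip N)) _
      (S.H.add_mem hZ (abs_sub_tail_mem hZ N)) fun ω => ?_)
      (S.subadd Z hZ _ (abs_sub_tail_mem hZ N))
    simp only [hψ, Pi.add_apply]
    have h1 := neg_abs_le (Z ω)
    have h2 := le_max_left (|Z ω| - N) 0
    have h3 := le_max_right (|Z ω| - N) 0
    exact max_le ((min_le_left _ _).trans (by linarith)) (by linarith)
  have := (tendsto_const_nhds (x := S.E Z)).add (tendsto_E_tail hreg hZ)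
  rw [add_zero] at this
  exact le_of_tendsto_of_tendsto' hlim this hbound

/-! ### Independence -/

theorem IsIID.indepOfPast {X : ℕ → Ω → ℝ} (hX : S.IsIID X) (n : ℕ) : S.IndepOfPast X n := by
  rcases Nat.eq_zero_or_pos n with rfl | hn
  · intro φ _
    have h : ∀ ω ω', (Fin.snoc (α := fun _ => ℝ) (fun i : Fin 0 => X i ω) (X 0 ω') :
        Fin (0 + 1) → ℝ) = fun i : Fin (0 + 1) => X i ω' := by
      intro ω ω'
      ext i
      rw [show i = Fin.last 0 from Subsingleton.elim (α := Fin 1) _ _, Fin.snoc_last]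
      rfl
    simp only [h, S.const]
  · exact hX.indep n hn

theorem dist_snoc_left_le {n : ℕ} (x y : Fin n → ℝ) (t : ℝ) :
    dist (Fin.snoc (α := fun _ => ℝ) x t : Fin (n + 1) → ℝ) (Fin.snoc (α := fun _ => ℝ) y t) ≤
      dist x y := by
  refine (dist_pi_le_iff dist_nonneg).2 fun i => ?_
  refine Fin.lastCases ?_ (fun j => ?_) i
  · simp
  · simpa using dist_le_pi_dist x y j

theorem lipschitzWith_snoc_right {n : ℕ} (x : Fin n → ℝ) :
    LipschitzWith 1 fun t => (Fin.snoc (α := fun _ => ℝ) x t : Fin (n + 1) → ℝ) :=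
  LipschitzWith.of_dist_le_mul fun s t => by
    rw [NNReal.coe_one, one_mul]
    refine (dist_pi_le_iff dist_nonneg).2 fun i => ?_
    refine Fin.lastCases ?_ (fun j => ?_) i
    · simp
    · simp

theorem isBddLip_E_snoc {n : ℕ} {φ : (Fin (n + 1) → ℝ) → ℝ} (hφ : IsBddLip φ) {Y : Ω → ℝ}
    (hY : Y ∈ S.H) :
    IsBddLip fun x : Fin n → ℝ => S.E fun ω => φ (Fin.snoc (α := fun _ => ℝ) x (Y ω)) := by
  obtain ⟨⟨K, hK⟩, C, hC⟩ := hφ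
  have hmem : ∀ x : Fin n → ℝ, (fun ω => φ (Fin.snoc (α := fun _ => ℝ) x (Y ω))) ∈ S.H := fun x =>
    comp_lipschitz_mem hY (hK.comp (lipschitzWith_snoc_right x))
  refine ⟨⟨K, LipschitzWith.of_le_add_mul K fun x y => ?_⟩, C, fun x => abs_le.2 ⟨?_, ?_⟩⟩
  · refine E_le_add_const (hmem x) (hmem y) fun ω => ?_
    have h1 := hK.dist_le_mul (Fin.snoc (α := fun _ => ℝ) x (Y ω))
      (Fin.snoc (α := fun _ => ℝ) y (Y ω))
    have h2 := mul_le_mul_of_nonneg_left (dist_snoc_left_le x y (Y ω)) K.coe_nonneg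
    have h3 := le_abs_self (φ (Fin.snoc (α := fun _ => ℝ) x (Y ω)) -
      φ (Fin.snoc (α := fun _ => ℝ) y (Y ω)))
    rw [Real.dist_eq] at h1
    linarith
  · have := S.mono _ (const_mem (-C)) _ (hmem x) fun ω => (abs_le.1 (hC _)).1
    rwa [S.const] at this
  · have := S.mono _ (hmem x) _ (const_mem C) fun ω => (abs_le.1 (hC _)).2
    rwa [S.const] at this

/-- The kernel laws are dominated by `E` on bounded Lipschitz functions: the last variable is
integrated out on one side by the kernel and on the other side by independence. -/
theorem integral_kernelLaw_le {X : ℕ → Ω → ℝ} (hX : S.IsIID X)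
    {κ : (n : ℕ) → Kernel (Fin n → ℝ) ℝ} [∀ n, IsMarkovKernel (κ n)]
    (hκ : ∀ n x, κ n x ∈ S.marginalLaws (X 0)) (n : ℕ) :
    ∀ φ : (Fin n → ℝ) → ℝ, IsBddLip φ →
      ∫ x, φ x ∂(kernelLaw κ n) ≤ S.E fun ω => φ fun i => X i ω := by
  induction n with
  | zero =>
    intro φ _
    have : (fun ω => φ fun i : Fin 0 => X i ω) = fun _ => φ fun i => i.elim0 := by
      ext ω; congr 1; ext i; exact i.elim0
    rw [this, S.const, kernelLaw, integral_dirac]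
  | succ n ih =>
    intro φ hφ
    have hψ := isBddLip_E_snoc hφ (hX.mem n)
    have hφm : Measurable φ := hφ.1.choose_spec.continuous.measurable
    obtain ⟨C, hC⟩ := hφ.2
    obtain ⟨C', hC'⟩ := hψ.2
    rw [integral_kernelLaw_succ n hφm hC, hX.indepOfPast n φ hφ]
    refine le_trans ?_ (ih _ hψ)
    refine integral_mono ?_ ?_ fun x => ?_
    · refine Integrable.of_bound (C := C) ?_ (Eventually.of_forall fun x => ?_)
      · exact ((hφm.comp measurable_snoc).stronglyMeasurable.integral_kernel_prod_right'
          (κ := κ n)).aestronglyMeasurable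
      · have := norm_integral_le_of_norm_le_const (μ := κ n x)
          (f := fun y => φ (Fin.snoc (α := fun _ => ℝ) x y))
          (Eventually.of_forall fun y => hC (Fin.snoc (α := fun _ => ℝ) x y))
        simpa using this
    · exact Integrable.of_bound hψ.1.choose_spec.continuous.measurable.aestronglyMeasurable C'
        (Eventually.of_forall hC')
    · have hlip := hφ.1.choose_spec.comp (lipschitzWith_snoc_right x)
      refine ((hκ n x).2 _ ⟨_, hlip⟩).2.trans (le_of_eq ?_)
      exact (hX.ident n _ ⟨_, hlip⟩ ⟨C, fun y => hC _⟩).symm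

theorem kernelLaws_subset_maximalLaws (hreg : S.Regular) {X : ℕ → Ω → ℝ} (hX : S.IsIID X) :
    kernelLaws (fun _ => S.marginalLaws (X 0)) ⊆ S.maximalLaws X := by
  rintro Q ⟨hQ, κ, hκm, hκ, hQκ⟩
  rw [forall_measure_eq_iterLIntegral_iff] at hQκ
  refine ⟨hQ, fun n φ ⟨K, hK⟩ => ?_⟩
  refine integrable_and_integral_le hreg (hK.continuous.measurable.comp (measurable_firstTerms n))
    (S.comp_mem n _ (fun i => hX.mem i) φ ⟨K, hK⟩) ?_
  rintro ψ ⟨K', hK'⟩ ⟨C, hC⟩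
  have h := integral_kernelLaw_le hX hκ n (fun x => ψ (φ x)) ⟨⟨_, hK'.comp hK⟩, C, fun x => hC _⟩
  have hm : Measurable fun x => ψ (φ x) := (hK'.comp hK).continuous.measurable
  rwa [← hQκ n, integral_map (measurable_firstTerms n).aemeasurable hm.aestronglyMeasurable] at h

end SublinearExpectationSpace

/-! ### Disintegration of a maximal law -/

namespace SublinearExpectationSpace

variable {Ω : Type*} {S : SublinearExpectationSpace Ω}

/-- The Lipschitz functions on `ℝ` bounded by `N`, with the topology of uniform convergence on
compact sets. -/
abbrev BoundedLipschitz (N : ℕ) : Type :=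
  {φ : C(ℝ, ℝ) // (∃ K : NNReal, LipschitzWith K φ) ∧ ∀ x, |φ x| ≤ N}

instance (N : ℕ) : Nonempty (BoundedLipschitz N) :=
  ⟨⟨0, ⟨0, LipschitzWith.const 0⟩, by simp⟩⟩

instance (N : ℕ) : SecondCountableTopology (BoundedLipschitz N) :=
  TopologicalSpace.Subtype.secondCountableTopology _

/-- Membership in the marginal set is decided by countably many bounded Lipschitz functions. -/
theorem mem_marginalLaws_of_denseSeq (hreg : S.Regular) {Z : Ω → ℝ} (hZ : Z ∈ S.H)
    {μ : Measure ℝ} [IsProbabilityMeasure μ]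
    (h : ∀ N k, ∫ x, (TopologicalSpace.denseSeq (BoundedLipschitz N) k).1 x ∂μ ≤
      S.E fun ω => (TopologicalSpace.denseSeq (BoundedLipschitz N) k).1 (Z ω)) :
    μ ∈ S.marginalLaws Z := by
  have hbdd : ∀ ψ : ℝ → ℝ, (∃ K : NNReal, LipschitzWith K ψ) → (∃ C : ℝ, ∀ x, |ψ x| ≤ C) →
      ∫ x, ψ x ∂μ ≤ S.E fun ω => ψ (Z ω) := by
    rintro ψ ⟨K, hK⟩ ⟨C, hC⟩
    obtain ⟨N, hN⟩ := exists_nat_ge C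
    have hψN : ∀ x, |ψ x| ≤ N := fun x => (hC x).trans hN
    let ψ' : BoundedLipschitz N := ⟨⟨ψ, hK.continuous⟩, ⟨K, hK⟩, hψN⟩
    obtain ⟨g, hg, hlim⟩ := mem_closure_iff_seq_limit.1
      (TopologicalSpace.denseRange_denseSeq (BoundedLipschitz N) ψ')
    have hunif : ∀ s : Set ℝ, IsCompact s →
        TendstoUniformlyOn (fun j x => (g j).1 x) ψ atTop s := fun s hs =>
      (ContinuousMap.tendsto_iff_forall_isCompact_tendstoUniformlyOn.1
        ((continuous_subtype_val.tendsto ψ').comp hlim)) s hs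
    have hgle : ∀ j, ∫ x, (g j).1 x ∂μ ≤ S.E fun ω => (g j).1 (Z ω) := by
      intro j
      obtain ⟨k, hk⟩ := hg j
      rw [← hk]
      exact h N k
    have hint : Tendsto (fun j => ∫ x, (g j).1 x ∂μ) atTop (𝓝 (∫ x, ψ x ∂μ)) := by
      refine tendsto_integral_of_dominated_convergence (fun _ => (N : ℝ))
        (fun j => (g j).1.continuous.measurable.aestronglyMeasurable) (integrable_const _)
        (fun j => Eventually.of_forall (g j).2.2) (Eventually.of_forall fun x => ?_)
      exact (hunif {x} isCompact_singleton).tendsto_at rfl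
    -- On `[-(m + 1), m + 1]` the approximation is uniform; outside, `|Z| - m ≥ 1` and the
    -- error is at most `2 N`.
    have hbound : ∀ (m : ℕ) (ε : ℝ), 0 < ε →
        ∫ x, ψ x ∂μ ≤ S.E (fun ω => ψ (Z ω)) + ε +
          2 * N * S.E fun ω => max (|Z ω| - m) 0 := by
      intro m ε hε
      refine le_of_tendsto hint ?_
      filter_upwards [Metric.tendstoUniformlyOn_iff.1
        (hunif (Set.Icc (-(m + 1 : ℝ)) (m + 1)) isCompact_Icc) ε hε] with j hj
      refine (hgle j).trans ?_
      obtain ⟨K', hK'⟩ := (g j).2.1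
      have htail := S.H.smul_mem (2 * N : ℝ) (abs_sub_tail_mem hZ (m : ℝ))
      have h1 : S.E (fun ω => (g j).1 (Z ω)) ≤
          S.E (fun ω => ψ (Z ω) + ((2 * N : ℝ) • fun ω => max (|Z ω| - m) 0) ω) + ε := by
        refine E_le_add_const (comp_lipschitz_mem hZ hK')
          (S.H.add_mem (comp_lipschitz_mem hZ hK) htail) fun ω => ?_
        have hN0 : (0 : ℝ) ≤ N := N.cast_nonneg
        have ht0 := le_max_right (|Z ω| - m) 0
        have ht1 := le_max_left (|Z ω| - m) 0
        change _ ≤ ψ (Z ω) + 2 * N * max (|Z ω| - m) 0 + ε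
        rcases le_total |Z ω| (m + 1) with hZm | hZm
        · have := hj (Z ω) (abs_le.1 hZm)
          rw [Real.dist_eq, abs_sub_comm] at this
          have h2 := (le_abs_self _).trans this.le
          have : 0 ≤ 2 * N * max (|Z ω| - m) 0 := by positivity
          linarith
        · have h2 := (abs_le.1 ((g j).2.2 (Z ω))).2
          have h3 := (abs_le.1 (hψN (Z ω))).1
          have : 2 * (N : ℝ) * 1 ≤ 2 * N * max (|Z ω| - m) 0 := by
            gcongr
            linarith
          linarith
      have h2 := S.subadd _ (comp_lipschitz_mem hZ hK) _ htail
      have h3 : S.E ((2 * N : ℝ) • fun ω => max (|Z ω| - m) 0) =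
          2 * N * S.E fun ω => max (|Z ω| - m) 0 :=
        S.pos_homog _ (by positivity) _ (abs_sub_tail_mem hZ (m : ℝ))
      linarith
    refine le_of_forall_pos_le_add fun ε hε => ?_
    have := ((tendsto_E_tail hreg hZ).const_mul (2 * N : ℝ)).const_add
      (S.E (fun ω => ψ (Z ω)) + ε)
    rw [mul_zero, add_zero] at this
    exact ge_of_tendsto' this fun m => hbound m ε hε
  refine ⟨inferInstance, fun φ ⟨K, hK⟩ => ?_⟩
  refine integrable_and_integral_le hreg hK.continuous.measurable (comp_lipschitz_mem hZ hK) ?_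
  rintro ψ ⟨K', hK'⟩ ⟨C, hC⟩
  exact hbdd _ ⟨_, hK'.comp hK⟩ ⟨C, fun x => hC _⟩

theorem isBddLip_mul_last {n : ℕ} {f : (Fin n → ℝ) → ℝ} (hf : ∃ K : NNReal, LipschitzWith K f)
    (hf0 : ∀ x, 0 ≤ f x) (hf1 : ∀ x, f x ≤ 1) {ψ : ℝ → ℝ} (hψ : ∃ K : NNReal, LipschitzWith K ψ)
    {C : ℝ} (hC : ∀ x, |ψ x| ≤ C) :
    IsBddLip fun z : Fin (n + 1) → ℝ => f (fun i => z i.castSucc) * ψ (z (Fin.last n)) := by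
  have hC0 : 0 ≤ C := (abs_nonneg _).trans (hC 0)
  obtain ⟨K, hK⟩ := IsLip.comp_reindex hf (Fin.castSucc (n := n))
  obtain ⟨K', hK'⟩ := hψ
  have hK'' : LipschitzWith (K' * 1) fun z : Fin (n + 1) → ℝ => ψ (z (Fin.last n)) :=
    hK'.comp (LipschitzWith.eval (Fin.last n))
  have hfa : ∀ x, |f x| ≤ 1 := fun x => abs_le.2 ⟨by linarith [hf0 x], hf1 x⟩
  refine ⟨⟨K * C.toNNReal + K' * 1, LipschitzWith.of_dist_le_mul fun z w => ?_⟩, C, fun z => ?_⟩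
  · have h1 := hK.dist_le_mul z w
    have h2 := hK''.dist_le_mul z w
    rw [Real.dist_eq] at h1 h2 ⊢
    have e : f (fun i => z i.castSucc) * ψ (z (Fin.last n)) -
        f (fun i => w i.castSucc) * ψ (w (Fin.last n)) =
        (f (fun i => z i.castSucc) - f (fun i => w i.castSucc)) * ψ (z (Fin.last n)) +
        f (fun i => w i.castSucc) * (ψ (z (Fin.last n)) - ψ (w (Fin.last n))) := by ring
    rw [e, NNReal.coe_add, NNReal.coe_mul K, Real.coe_toNNReal C hC0]
    refine (abs_add_le _ _).trans ?_
    rw [abs_mul, abs_mul]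
    have h3 := mul_le_mul h1 (hC (z (Fin.last n))) (abs_nonneg _) (by positivity)
    have h4 := mul_le_mul (hfa fun i => w i.castSucc) h2 (abs_nonneg _) zero_le_one
    linarith
  · rw [abs_mul]
    simpa using mul_le_mul (hfa _) (hC _) (abs_nonneg _) zero_le_one

/-- The one-step conditional domination, tested against a function `f` of the past: by
independence `E[f(X₀, …, Xₙ₋₁) (ψ(Xₙ) - E[ψ(X₀)])] = 0` for `f ≥ 0`. -/
theorem integral_mul_le_of_mem_maximalLaws {X : ℕ → Ω → ℝ} (hX : S.IsIID X)
    {Q : Measure (ℕ → ℝ)} (hQ : Q ∈ S.maximalLaws X) {n : ℕ} {f : (Fin n → ℝ) → ℝ}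
    (hf : ∃ K : NNReal, LipschitzWith K f) (hf0 : ∀ x, 0 ≤ f x) (hf1 : ∀ x, f x ≤ 1)
    {ψ : ℝ → ℝ} (hψ : ∃ K : NNReal, LipschitzWith K ψ) {C : ℝ} (hC : ∀ x, |ψ x| ≤ C) :
    ∫ y, f (firstTerms n y) * (ψ (y n) - S.E fun ω => ψ (X 0 ω)) ∂Q ≤ 0 := by
  set c := S.E fun ω => ψ (X 0 ω) with hc
  obtain ⟨K, hK⟩ := hψ
  have hKc : LipschitzWith (K + 0) fun t => ψ t - c := hK.sub (LipschitzWith.const c)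
  have hCc : ∀ x, |ψ x - c| ≤ C + |c| := fun x => (abs_sub _ _).trans (by gcongr; exact hC x)
  have hΦ := isBddLip_mul_last hf hf0 hf1 ⟨_, hKc⟩ hCc
  refine (hQ.2 (n + 1) _ hΦ.1).2.trans (le_of_eq ?_)
  rw [hX.indepOfPast n _ hΦ]
  have hmean : S.E (fun ω => ψ (X n ω) - c) = 0 := by
    have h1 : S.E (fun ω => ψ (X n ω) - c) = S.E fun ω => ψ (X 0 ω) - c :=
      hX.ident n (fun t => ψ t - c) ⟨_, hKc⟩ ⟨_, hCc⟩
    have hm := comp_lipschitz_mem (hX.mem 0) hK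
    have hmc := comp_lipschitz_mem (hX.mem 0) hKc
    have h2 := E_le_add_const hmc hm (c := -c) fun ω => le_of_eq (sub_eq_add_neg _ _)
    have h3 := E_le_add_const hm hmc (c := c) fun ω => by linarith
    rw [h1]
    linarith
  have hinner : ∀ ω, S.E (fun ω' => f (fun i : Fin n =>
      (Fin.snoc (α := fun _ => ℝ) (fun i : Fin n => X i ω) (X n ω') : Fin (n + 1) → ℝ) i.castSucc) *
      (ψ ((Fin.snoc (α := fun _ => ℝ) (fun i : Fin n => X i ω) (X n ω') : Fin (n + 1) → ℝ)
        (Fin.last n)) - c)) = 0 := by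
    intro ω
    simp only [Fin.snoc_castSucc, Fin.snoc_last]
    rw [S.pos_homog _ (hf0 _) _ (comp_lipschitz_mem (hX.mem n) hKc), hmean, mul_zero]
  simp only [hinner]
  exact S.const 0

theorem ae_condDistrib_mem_marginalLaws (hreg : S.Regular) {X : ℕ → Ω → ℝ} (hX : S.IsIID X)
    {Q : Measure (ℕ → ℝ)} [IsProbabilityMeasure Q] (hQ : Q ∈ S.maximalLaws X) (n : ℕ) :
    ∀ᵐ x ∂(Q.map (firstTerms n)),
      condDistrib (fun y : ℕ → ℝ => y n) (firstTerms n) Q x ∈ S.marginalLaws (X 0) := by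
  set κ := condDistrib (fun y : ℕ → ℝ => y n) (firstTerms n) Q with hκ
  have hfm := measurable_firstTerms n
  have hcomp : (Q.map (firstTerms n)) ⊗ₘ κ = Q.map fun y => (firstTerms n y, y n) :=
    compProd_map_condDistrib (measurable_pi_apply n).aemeasurable
  have : IsProbabilityMeasure (Q.map (firstTerms n)) :=
    Measure.isProbabilityMeasure_map hfm.aemeasurable
  have key : ∀ N k, ∀ᵐ x ∂(Q.map (firstTerms n)),
      ∫ t, (TopologicalSpace.denseSeq (BoundedLipschitz N) k).1 t ∂(κ x) ≤
        S.E fun ω => (TopologicalSpace.denseSeq (BoundedLipschitz N) k).1 (X 0 ω) := by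
    intro N k
    obtain ⟨ψ, hψ, hψN⟩ := TopologicalSpace.denseSeq (BoundedLipschitz N) k
    simp only
    set c := S.E fun ω => ψ (X 0 ω) with hc
    have hcN : -(N : ℝ) ≤ c := by
      have := S.mono _ (const_mem (-(N : ℝ))) _ (comp_lipschitz_mem (hX.mem 0) hψ.choose_spec)
        fun ω => (abs_le.1 (hψN _)).1
      rwa [S.const] at this
    have hψm : Measurable ψ := ψ.continuous.measurable
    -- `ψ` is shifted by `N` to make it nonnegative.
    have hae := Kernel.ae_integral_le_of_compProd (μ := Q.map (firstTerms n)) (κ := κ)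
      (u := fun t => ψ t + N) (hψm.add_const _) (fun t => by linarith [(abs_le.1 (hψN t)).1])
      (B := 2 * N) (fun t => by linarith [(abs_le.1 (hψN t)).2]) (c := c + N) (by linarith) ?_
    · filter_upwards [hae] with x hx
      rw [integral_add (Integrable.of_bound hψm.aestronglyMeasurable N
        (Eventually.of_forall hψN)) (integrable_const _)] at hx
      simpa using hx
    · intro f hf hf0 hf1
      have hfmeas : Measurable f := hf.choose_spec.continuous.measurable
      have hm : Measurable fun p : (Fin n → ℝ) × ℝ => f p.1 * (ψ p.2 + N) :=
        (hfmeas.comp measurable_fst).mul ((hψm.comp measurable_snd).add_const _)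
      rw [hcomp, integral_map (hfm.prodMk (measurable_pi_apply n)).aemeasurable
        hm.aestronglyMeasurable, integral_map hfm.aemeasurable hfmeas.aestronglyMeasurable]
      have hle := integral_mul_le_of_mem_maximalLaws hX hQ hf hf0 hf1 hψ hψN
      have hfint : Integrable (fun y => f (firstTerms n y)) Q :=
        Integrable.of_bound (hfmeas.comp hfm).aestronglyMeasurable 1
          (Eventually.of_forall fun y => by rw [Real.norm_of_nonneg (hf0 _)]; exact hf1 _)
      have hprod : Integrable (fun y => f (firstTerms n y) * (ψ (y n) - c)) Q := by
        refine Integrable.of_bound (C := 1 * (N + |c|)) ((hfmeas.comp hfm).mul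
          ((hψm.comp (measurable_pi_apply n)).sub_const c)).aestronglyMeasurable
          (Eventually.of_forall fun y => ?_)
        rw [norm_mul, Real.norm_of_nonneg (hf0 _), Real.norm_eq_abs]
        exact mul_le_mul (hf1 _) ((abs_sub _ _).trans (by gcongr; exact hψN _)) (abs_nonneg _)
          zero_le_one
      have e : ∀ y : ℕ → ℝ, f (firstTerms n y) * (ψ (y n) + N) =
          f (firstTerms n y) * (ψ (y n) - c) + (c + N) * f (firstTerms n y) := fun y => by ring
      simp only [e]
      rw [integral_add hprod (hfint.const_mul _), integral_const_mul]
      linarith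
  filter_upwards [ae_all_iff.2 fun N => ae_all_iff.2 (key N)] with x hx
  exact mem_marginalLaws_of_denseSeq hreg (hX.mem 0) hx

theorem maximalLaws_subset_kernelLaws (hreg : S.Regular) {X : ℕ → Ω → ℝ} (hX : S.IsIID X) :
    S.maximalLaws X ⊆ kernelLaws fun _ => S.marginalLaws (X 0) := by
  intro Q hQ
  have hQp : IsProbabilityMeasure Q := hQ.1
  have hstep : ∀ n, ∃ κ : Kernel (Fin n → ℝ) ℝ, IsMarkovKernel κ ∧
      (∀ x, κ x ∈ S.marginalLaws (X 0)) ∧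
      (Q.map (firstTerms n)) ⊗ₘ κ = Q.map fun y => (firstTerms n y, y n) := by
    intro n
    have hfm := measurable_firstTerms n
    have hp : IsProbabilityMeasure (Q.map (firstTerms n)) :=
      Measure.isProbabilityMeasure_map hfm.aemeasurable
    have hae := ae_condDistrib_mem_marginalLaws hreg hX hQ n
    set κ₀ := condDistrib (fun y : ℕ → ℝ => y n) (firstTerms n) Q with hκ₀
    obtain ⟨x₀, hx₀⟩ := hae.exists
    obtain ⟨s, hs, hsm, hs0⟩ := exists_measurable_superset_of_null (ae_iff.1 hae)
    -- The conditional law is replaced by a fixed marginal law on a null set.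
    classical
    let κ : Kernel (Fin n → ℝ) ℝ := Kernel.piecewise hsm (Kernel.const _ (κ₀ x₀)) κ₀
    have hκ : ∀ x, κ x = if x ∈ s then κ₀ x₀ else κ₀ x := fun x => by
      simp [κ, Kernel.piecewise_apply]
    have hκae : κ =ᵐ[Q.map (firstTerms n)] κ₀ := by
      filter_upwards [compl_mem_ae_iff.2 hs0] with x hx
      rw [hκ, if_neg hx]
    refine ⟨κ, inferInstance, fun x => ?_, ?_⟩
    · rw [hκ]
      split_ifs with hx
      · exact hx₀
      · by_contra hcon
        exact hx (hs hcon)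
    · rw [Measure.compProd_congr hκae]
      exact compProd_map_condDistrib (measurable_pi_apply n).aemeasurable
  choose κ hκm hκ hκQ using hstep
  refine ⟨hQp, κ, hκm, hκ, forall_measure_eq_iterLIntegral_iff.2 fun n => ?_⟩
  induction n with
  | zero =>
    have hp : IsProbabilityMeasure (Q.map (firstTerms 0)) :=
      Measure.isProbabilityMeasure_map (measurable_firstTerms 0).aemeasurable
    ext s _
    rcases s.eq_empty_or_nonempty with rfl | hs
    · simp
    · rw [Subsingleton.eq_univ_of_nonempty hs, measure_univ, measure_univ]
  | succ n ih =>
    rw [kernelLaw, ← ih, hκQ n, Measure.map_map measurable_snoc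
      ((measurable_firstTerms n).prodMk (measurable_pi_apply n))]
    congr 1
    ext y i
    refine Fin.lastCases ?_ (fun j => ?_) i
    · simp [firstTerms]
    · simp [firstTerms]

end SublinearExpectationSpace

/-! ### Image laws -/

/-- The Lipschitz functions on `ℝ^ℕ` depending on finitely many coordinates. -/
def cylinderLipschitz : Submodule ℝ ((ℕ → ℝ) → ℝ) where
  carrier := {g | ∃ (n : ℕ) (φ : (Fin n → ℝ) → ℝ), IsLip φ ∧ g = fun y => φ fun i => y i}
  zero_mem' := ⟨0, fun _ => 0, ⟨0, LipschitzWith.const 0⟩, rfl⟩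
  add_mem' := by
    rintro _ _ ⟨n, φ, hφ, rfl⟩ ⟨m, ψ, hψ, rfl⟩
    exact ⟨max n m, _, (hφ.comp_reindex (Fin.castLE (le_max_left n m))).add
      (hψ.comp_reindex (Fin.castLE (le_max_right n m))), rfl⟩
  smul_mem' := by
    rintro c _ ⟨n, φ, hφ, rfl⟩
    exact ⟨n, _, hφ.const_mul c, rfl⟩

namespace SublinearExpectationSpace

variable {Ω : Type*} {S : SublinearExpectationSpace Ω}

theorem measurable_process {X : ℕ → Ω → ℝ} (hX : ∀ i, X i ∈ S.H) :
    Measurable[S.sigmaH] fun ω i => X i ω :=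
  let _ : MeasurableSpace Ω := S.sigmaH
  measurable_pi_iff.2 fun i => measurable_of_mem (hX i)

theorem imageLaws_subset_maximalLaws {X : ℕ → Ω → ℝ} (hX : ∀ i, X i ∈ S.H) :
    S.imageLaws X ⊆ S.maximalLaws X := by
  rintro _ ⟨P, hP, rfl⟩
  let _ : MeasurableSpace Ω := S.sigmaH
  have hm := measurable_process hX
  have := hP.1
  refine ⟨Measure.isProbabilityMeasure_map hm.aemeasurable, fun n φ hφ => ?_⟩
  have hφm : Measurable fun y : ℕ → ℝ => φ fun i => y i :=
    hφ.choose_spec.continuous.measurable.comp (measurable_firstTerms n)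
  have hmem := hP.2 _ (S.comp_mem n _ (fun i => hX i) φ hφ)
  rw [integral_map hm.aemeasurable hφm.aestronglyMeasurable,
    integrable_map_measure hφm.aestronglyMeasurable hm.aemeasurable]
  exact hmem

/-- A maximal law defines a linear functional on the cylinder functions of `X`, which extends to
a measure in `P_*`. -/
theorem maximalLaws_subset_imageLaws (hreg : S.Regular) {X : ℕ → Ω → ℝ} (hX : ∀ i, X i ∈ S.H) :
    S.maximalLaws X ⊆ S.imageLaws X := by
  intro Q hQ
  have hQp : IsProbabilityMeasure Q := hQ.1
  have hint : ∀ g ∈ cylinderLipschitz, Integrable g Q := by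
    rintro _ ⟨n, φ, hφ, rfl⟩
    exact (hQ.2 n φ hφ).1
  let T : cylinderLipschitz →ₗ[ℝ] S.H :=
    ((LinearMap.funLeft ℝ ℝ fun ω i => X i ω).comp cylinderLipschitz.subtype).codRestrict S.H (by
      rintro ⟨_, n, φ, hφ, rfl⟩
      exact S.comp_mem n _ (fun i => hX i) φ hφ)
  let l : cylinderLipschitz →ₗ[ℝ] ℝ :=
    { toFun := fun g => ∫ y, g.1 y ∂Q
      map_add' := fun g g' => integral_add (hint _ g.2) (hint _ g'.2)
      map_smul' := fun c g => integral_const_mul c _ }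
  obtain ⟨P, hP, hPl⟩ := exists_dominatedMeasure hreg T l (by
    rintro ⟨_, n, φ, hφ, rfl⟩
    exact (hQ.2 n φ hφ).2)
  refine ⟨P, hP, ?_⟩
  let _ : MeasurableSpace Ω := S.sigmaH
  have hm := measurable_process hX
  have hPp := hP.1
  refine Measure.ext_of_map_firstTerms fun n => ?_
  have hfm := measurable_firstTerms n
  have hp₁ : IsProbabilityMeasure (Q.map (firstTerms n)) :=
    Measure.isProbabilityMeasure_map hfm.aemeasurable
  have hp₂ : IsProbabilityMeasure (P.map fun ω i => X i ω) :=
    Measure.isProbabilityMeasure_map hm.aemeasurable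
  have hp₃ : IsProbabilityMeasure ((P.map fun ω i => X i ω).map (firstTerms n)) :=
    Measure.isProbabilityMeasure_map hfm.aemeasurable
  have heq : ∀ φ : (Fin n → ℝ) → ℝ, IsLip φ → ∫ x, φ x ∂(Q.map (firstTerms n)) =
      ∫ x, φ x ∂((P.map fun ω i => X i ω).map (firstTerms n)) := by
    intro φ hφ
    have hφm : Measurable φ := hφ.choose_spec.continuous.measurable
    have hφf : Measurable fun y => φ (firstTerms n y) := hφm.comp hfm
    rw [integral_map hfm.aemeasurable hφm.aestronglyMeasurable,
      integral_map hfm.aemeasurable hφm.aestronglyMeasurable,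
      integral_map hm.aemeasurable hφf.aestronglyMeasurable]
    exact (hPl ⟨_, n, φ, hφ, rfl⟩).symm
  exact le_antisymm (Measure.le_of_forall_lipschitz_integral_le fun f hf _ _ => (heq f hf).le)
    (Measure.le_of_forall_lipschitz_integral_le fun f hf _ _ => (heq f hf).ge)

theorem extE_comp_eq {X : ℕ → Ω → ℝ} (hX : ∀ i, X i ∈ S.H) {g : (ℕ → ℝ) → ℝ}
    (hg : Measurable g) :
    S.extE (fun ω => g fun i => X i ω) = upperExpectation (S.imageLaws X) g := by
  let _ : MeasurableSpace Ω := S.sigmaH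
  have hm := measurable_process hX
  rw [extE, upperExpectation, upperExpectation]
  congr 1
  ext r
  constructor
  · rintro ⟨P, hP, rfl⟩
    exact ⟨_, ⟨P, hP, rfl⟩, integral_map hm.aemeasurable hg.aestronglyMeasurable⟩
  · rintro ⟨_, ⟨P, hP, rfl⟩, rfl⟩
    exact ⟨P, hP, (integral_map hm.aemeasurable hg.aestronglyMeasurable).symm⟩

end SublinearExpectationSpace

/-! ### Equality of the three sets of laws -/

open SublinearExpectationSpace in
theorem mainTheorem6 {Ω : Type*} (S : SublinearExpectationSpace Ω) (hreg : S.Regular)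
    (X : ℕ → Ω → ℝ) (hX : S.IsIID X)
    (hui : Tendsto (fun l : ℝ => S.E (fun ω => max (|X 0 ω| - l) 0)) atTop (𝓝 0)) :
    (S.imageLaws X = kernelLaws (fun _ => S.marginalLaws (X 0)) ∧
      kernelLaws (fun _ => S.marginalLaws (X 0)) = S.maximalLaws X) ∧
    (S.dominatedMeasures.Nonempty ∧ ∀ Z ∈ S.H, S.extE Z = S.E Z) ∧
    ∀ (n : ℕ) (f : (Fin n → ℝ) → ℝ), Measurable f → (∃ C : ℝ, ∀ x, |f x| ≤ C) →
      S.extE (fun ω => f (fun i => X i ω)) =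
        upperExpectation (kernelLaws (fun _ => S.marginalLaws (X 0)))
          (fun y : ℕ → ℝ => f (fun i => y i)) := by
  have hkm : kernelLaws (fun _ => S.marginalLaws (X 0)) = S.maximalLaws X :=
    (kernelLaws_subset_maximalLaws hreg hX).antisymm (maximalLaws_subset_kernelLaws hreg hX)
  have him : S.imageLaws X = S.maximalLaws X :=
    (imageLaws_subset_maximalLaws hX.mem).antisymm (maximalLaws_subset_imageLaws hreg hX.mem)
  refine ⟨⟨him.trans hkm.symm, hkm⟩, ⟨?_, fun Z hZ => extE_eq hreg hZ⟩, fun n f hf _ => ?_⟩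
  · obtain ⟨P, hP, _⟩ := exists_dominatedMeasure_integral_eq hreg (const_mem (S := S) 0)
    exact ⟨P, hP⟩
  · rw [hkm, ← him]
    exact extE_comp_eq hX.mem (hf.comp (measurable_firstTerms n))
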